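/- Let $\langle S\mid R\rangle$ be a group presentation in which every relator $r\in R$ is a reduced word of the same length $\ell$ in the generators $S$ and their inverses. A van Kampen diagram $D$ over this presentation is a finite, connected, simply connected planar 2-complex whose oriented edges are labelled by letters of $S^{\pm1}$ (opposite orientations carrying inverse letters) such that the word read around each face is, up to cyclic permutation, a relator or the inverse of a relator. Write $|D|$ for the number of faces of $D$ and $|\partial D|$ for its boundary length, i.e. the length of the boundary cycle. The diagram $D$ is reduced if no edge has faces on its two sides that cancel, i.e. whose boundary words, read from that edge, are mirror images of each other. Suppose that for some $C>0$ every reduced van Kampen diagram $D$ satisfies $$|\partial D|\ge C\,\ell\,|D|.$$ Let $K\ge 3000/C^5$ and let $\beta\in\mathbb{R}$ be such that every reduced van Kampen diagram $D$ with at most $K$ faces satisfies $$|\partial D|\ge \beta\,\ell\,|D|.$$ Then every reduced van Kampen diagram $D$ satisfies $$|\partial D|\ge\Bigl(\beta-\frac{14}{\sqrt{KC}}\Bigr)\ell\,|D|.$$ -/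

import Mathlib

/-- A finite connected planar map of disc type: a finite, connected and simply connected planar
2-complex (a tree-like arrangement of discs, possibly with filaments; a single vertex is allowed),
given combinatorially by its oriented edges ("darts").

* Each edge carries two darts, exchanged by the fixed-point free involution `rev`.
* `src d` is the vertex from which the dart `d` starts.
* `left d` is the region to the left of `d`: `some f` for a (bounded, open) face `f` of the
  complex, and `none` for the unbounded region of the plane.
* `next d` is the dart following `d` on the boundary cycle of the region to the left of `d`.
  So the regions (the outer one included) are exactly the cycles of `next`, and `d ↦ next (rev d)`
  is the rotation of the darts around their starting vertex, whose cycles are the vertices.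
* Planarity (genus zero) is Euler's formula; the outer region is not counted as a face. -/
structure DiscMap where
  Vertex : Type
  Dart : Type
  Face : Type
  finite_vertex : Finite Vertex
  finite_dart : Finite Dart
  finite_face : Finite Face
  rev : Equiv.Perm Dart
  rev_rev : ∀ d, rev (rev d) = d
  rev_ne : ∀ d, rev d ≠ d
  next : Equiv.Perm Dart
  src : Dart → Vertex
  left : Dart → Option Face
  /-- The darts starting at a given vertex form one cycle of the rotation `d ↦ next (rev d)`. -/
  src_eq_iff : ∀ d e, src d = src e ↔ (next * rev).SameCycle d e
  /-- The darts with a given region to their left form one cycle of `next`. -/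
  left_eq_iff : ∀ d e, left d = left e ↔ next.SameCycle d e
  exists_left_eq_some : ∀ f : Face, ∃ d, left d = some f
  exists_left_eq_none : Nonempty Dart → ∃ d, left d = none
  nonempty_vertex : Nonempty Vertex
  connected : ∀ u v : Vertex,
    Relation.ReflTransGen (fun a b => ∃ d, src d = a ∧ src (rev d) = b) u v
  /-- Euler's formula `V - E + F = 1`, where `2 * E` is the number of darts. -/
  euler : (Nat.card Vertex : ℤ) - (Nat.card Dart / 2 : ℕ) + Nat.card Face = 1

namespace DiscMap

/-- The number of faces, `|D|`. -/
noncomputable def numFaces (D : DiscMap) : ℕ := Nat.card D.Face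

/-- The length of the boundary cycle of a region. -/
noncomputable def regionLength (D : DiscMap) (f : Option D.Face) : ℕ :=
  Nat.card {d : D.Dart // D.left d = f}

/-- The boundary length `|∂D|`: the length of the boundary cycle of the outer region, that is, of
the boundary word. An edge with the outer region on both sides is travelled twice. -/
noncomputable def boundaryLength (D : DiscMap) : ℕ := D.regionLength none

/-- The darts of the boundary cycle of the region to the left of `d`, in order, starting at `d`. -/
noncomputable def boundaryCycle (D : DiscMap) (d : D.Dart) : List D.Dart :=
  List.iterate D.next d (D.regionLength (D.left d))

end DiscMap

/-- A van Kampen diagram over the presentation with generators `α` and relators `R`: a disc map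
whose oriented edges are labelled by letters `(x, true) = x` and `(x, false) = x⁻¹`, opposite darts
carrying inverse letters, such that the word read around each face is, up to the choice of the
starting point, a relator or the inverse of a relator. -/
structure VanKampenDiagram {α : Type*} (R : Set (List (α × Bool))) extends DiscMap where
  label : Dart → α × Bool
  label_rev : ∀ d, label (rev d) = ((label d).1, !(label d).2)
  face_relator : ∀ (d : Dart) (f : Face), left d = some f →
    ∃ r ∈ R, (toDiscMap.boundaryCycle d).map label ~r r ∨
      (toDiscMap.boundaryCycle d).map label ~r FreeGroup.invRev r

namespace VanKampenDiagram

variable {α : Type*} {R : Set (List (α × Bool))}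

/-- The word read around the region to the left of `d`, starting with the letter of `d`. -/
noncomputable def word (D : VanKampenDiagram R) (d : D.Dart) : List (α × Bool) :=
  (D.boundaryCycle d).map D.label

/-- A diagram is reduced if it contains no cancelling pair of faces: an edge `e` together with faces
on its two sides with boundary cycles `e δ₁` and `e⁻¹ δ₂` such that the words read along
`δ₁` and `δ₂` are inverse to each other (i.e. the two faces are mirror images through `e`). -/
def IsReduced (D : VanKampenDiagram R) : Prop :=
  ∀ (d : D.Dart) (f g : D.Face), D.left d = some f → D.left (D.rev d) = some g →
    (D.word d).tail ≠ FreeGroup.invRev (D.word (D.rev d)).tail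

end VanKampenDiagram

/-! A large diagram is cut along a short path into two parts of comparable size; induction applies
to the parts, and concavity of the square root pays for the cut. For N > K faces the bound proved
has the density β - 14/√(KC) + 7/√(NC), whose last term contributes 7√(N/C)ℓ to the perimeter. If
the parts have x and y faces, both at least N/4, then √x + √y ≥ 1.36√N, a gain of 2.52√(N/C)ℓ. The
cut has length at most 1.22√(N/C)ℓ and is counted on both sides, a cost of 2.44√(N/C)ℓ. Each part
has more than K/4 faces, so its correction is at most 14/√(KC), and its discs with at most K faces
are covered by the local hypothesis (`le_boundaryLength_of_large`).

Short cuts exist because the linear inequality makes successive layers shrink geometrically, so that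
every face is at logarithmic depth h (`nearBoundary_eq_univ`, `exists_depth_bound`). Join every
vertex to the boundary by a path of at most ℓh edges. If every short chain between boundary vertices
cut off less than a third of the faces on one side, these small sides would be additive mod 2.
Summed around a face they give that face; summed over all faces they cancel in pairs, which is
absurd (`exists_balanced_cut`).

To apply the hypotheses to a part, it must be a union of discs. Filling holes achieves this at
bounded cost (`exists_cosimple_cut`). A connected set of faces with connected complement is again a
planar diagram (`exists_subdiagram`): Euler's formula is equivalent to the statement that every mod
2 cycle bounds, and the latter passes to the submap. -/

section ChainComplex

/-! ### Mod 2 cycle spaces and Euler's formula. -/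

variable {X V : Type*}

/-- The mod 2 chains on the edges of a graph, as functions on the darts invariant under reversal. -/
def symChains (rev : Equiv.Perm X) : Submodule (ZMod 2) (X → ZMod 2) where
  carrier := {x | ∀ d, x (rev d) = x d}
  add_mem' := fun ha hb d => by simp only [Pi.add_apply, ha d, hb d]
  zero_mem' := fun _ => rfl
  smul_mem' := fun c x hx d => by simp only [Pi.smul_apply, hx d]

/-- The coboundary of a function on the vertices. -/
def coboundary (rev : Equiv.Perm X) (hrev : ∀ d, rev (rev d) = d) (s : X → V) :
    (V → ZMod 2) →ₗ[ZMod 2] symChains rev where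
  toFun c := ⟨fun d => c (s d) + c (s (rev d)), fun d => by simp only [hrev, add_comm]⟩
  map_add' a b := by ext d; simp only [Pi.add_apply, Submodule.coe_add]; ring
  map_smul' a b := by ext d; simp [mul_add]

open Classical in
/-- The boundary of a chain. -/
noncomputable def bdry [Fintype X] (s : X → V) : (X → ZMod 2) →ₗ[ZMod 2] (V → ZMod 2) where
  toFun x v := ∑ d, if s d = v then x d else 0
  map_add' a b := by
    ext v
    simp only [Pi.add_apply, ← Finset.sum_add_distrib]
    exact Finset.sum_congr rfl fun d _ => by split_ifs <;> simp
  map_smul' a b := by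
    ext v
    simp only [Pi.smul_apply, RingHom.id_apply, smul_eq_mul, Finset.mul_sum]
    exact Finset.sum_congr rfl fun d _ => by split_ifs <;> simp

/-- The mod 2 cycle space of a graph. -/
noncomputable def cycleSpace [Fintype X] (rev : Equiv.Perm X) (s : X → V) :
    Submodule (ZMod 2) (symChains rev) :=
  LinearMap.ker ((bdry s).domRestrict (symChains rev))

/-- The chain consisting of the edge carrying the dart `d`. -/
noncomputable def edgeChain (rev : Equiv.Perm X) (d : X) : X → ZMod 2 :=
  open Classical in Pi.single d 1 + Pi.single (rev d) 1

theorem edgeChain_mem (rev : Equiv.Perm X) (hrev : ∀ d, rev (rev d) = d) (d : X) :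
    edgeChain rev d ∈ symChains rev := by
  classical
  intro e
  have h1 : rev e = d ↔ e = rev d := ⟨fun h => by rw [← h, hrev], fun h => by rw [h, hrev]⟩
  have h2 : rev e = rev d ↔ e = d := rev.injective.eq_iff
  simp only [edgeChain, Pi.add_apply, Pi.single_apply, h1, h2]
  rw [add_comm]

theorem edgeChain_rev (rev : Equiv.Perm X) (hrev : ∀ d, rev (rev d) = d) (d : X) :
    edgeChain rev (rev d) = edgeChain rev d := by
  classical
  simp only [edgeChain, hrev]
  rw [add_comm]

theorem bdry_single [Fintype X] [DecidableEq X] [DecidableEq V] (s : X → V) (d : X) :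
    bdry s (Pi.single d 1) = Pi.single (s d) 1 := by
  ext v
  simp only [bdry, LinearMap.coe_mk, AddHom.coe_mk]
  rw [Finset.sum_eq_single d]
  · simp [Pi.single_apply, eq_comm]
  · intro b _ hb
    simp [hb]
  · simp

theorem bdry_edgeChain [Fintype X] [DecidableEq V] (rev : Equiv.Perm X) (s : X → V) (d : X) :
    bdry s (edgeChain rev d) = Pi.single (s d) 1 + Pi.single (s (rev d)) 1 := by
  classical
  rw [edgeChain, map_add, bdry_single, bdry_single]

theorem ZMod2.add_self (a : ZMod 2) : a + a = 0 := CharTwo.add_self_eq_zero a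

theorem ZMod2.fun_add_self (f : V → ZMod 2) : f + f = 0 := funext fun _ => ZMod2.add_self _

/-- The operator 1 + `rev` has the symmetric chains both as kernel and, since `rev` has no fixed
points, as image. -/
theorem two_mul_finrank_symChains [Fintype X] (rev : Equiv.Perm X) (hrev : ∀ d, rev (rev d) = d)
    (hne : ∀ d, rev d ≠ d) :
    2 * Module.finrank (ZMod 2) (symChains rev) = Fintype.card X := by
  classical
  let T : (X → ZMod 2) →ₗ[ZMod 2] (X → ZMod 2) := LinearMap.id + LinearMap.funLeft _ _ rev
  have hT : ∀ x d, T x d = x d + x (rev d) := fun x d => rfl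
  have hker : LinearMap.ker T = symChains rev := by
    ext x
    rw [LinearMap.mem_ker]
    constructor
    · intro h d
      have := congrFun h d
      rw [hT, Pi.zero_apply, CharTwo.add_eq_zero] at this
      exact this.symm
    · intro h
      ext d
      rw [hT, h d, Pi.zero_apply, ZMod2.add_self]
  have hrange : LinearMap.range T = symChains rev := by
    ext x
    constructor
    · rintro ⟨y, rfl⟩ d
      rw [hT, hT, hrev, add_comm]
    · intro h
      let φ := Fintype.equivFin X
      -- A numbering of the darts selects one dart of each edge.
      refine ⟨fun d => if φ d < φ (rev d) then x d else 0, ?_⟩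
      ext d
      rw [hT]
      have hn : φ d ≠ φ (rev d) := fun h => hne d (φ.injective h).symm
      rcases lt_or_gt_of_ne hn with h1 | h1
      · simp [hrev, h1, h1.not_gt]
      · simp only [hrev, h1, h1.not_gt, if_true, if_false, zero_add]
        exact h d
  have := LinearMap.finrank_range_add_finrank_ker T
  rw [hker, hrange, Module.finrank_fintype_fun_eq_card] at this
  omega

/-- Adjacency of vertices. -/
def DartAdj (rev : Equiv.Perm X) (s : X → V) (u v : V) : Prop := ∃ d, s d = u ∧ s (rev d) = v

theorem sum_eq_zero_of_mem_symChains [Fintype X] (rev : Equiv.Perm X)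
    (hrev : ∀ d, rev (rev d) = d) (hne : ∀ d, rev d ≠ d) {x : X → ZMod 2}
    (hx : x ∈ symChains rev) : ∑ d, x d = 0 :=
  Finset.sum_involution (fun d _ => rev d) (fun d _ => by rw [hx d, ZMod2.add_self])
    (fun d _ _ => hne d) (fun _ _ => Finset.mem_univ _) (fun d _ => hrev d)

theorem exists_chain_of_reflTransGen [Fintype X] [DecidableEq V] (rev : Equiv.Perm X)
    (hrev : ∀ d, rev (rev d) = d) (s : X → V) {u v : V}
    (h : Relation.ReflTransGen (DartAdj rev s) u v) :
    ∃ x ∈ symChains rev, bdry s x = Pi.single u 1 + Pi.single v 1 := by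
  induction h with
  | refl => exact ⟨0, Submodule.zero_mem _, by rw [map_zero, ZMod2.fun_add_self]⟩
  | @tail v w _ hd ih =>
    obtain ⟨x, hx, hb⟩ := ih
    obtain ⟨d, rfl, rfl⟩ := hd
    refine ⟨x + edgeChain rev d, Submodule.add_mem _ hx (edgeChain_mem rev hrev d), ?_⟩
    rw [map_add, hb, bdry_edgeChain, add_assoc, ← add_assoc (Pi.single (s d) 1),
      ZMod2.fun_add_self, zero_add]

/-- By connectedness the boundary map is onto the chains of even total, which have codimension 1. -/
theorem finrank_cycleSpace [Fintype X] [Fintype V] [Nonempty V] (rev : Equiv.Perm X)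
    (hrev : ∀ d, rev (rev d) = d) (hne : ∀ d, rev d ≠ d) (s : X → V)
    (hconn : ∀ u v, Relation.ReflTransGen (DartAdj rev s) u v) :
    Module.finrank (ZMod 2) (cycleSpace rev s) + Fintype.card V =
      Module.finrank (ZMod 2) (symChains rev) + 1 := by
  classical
  let aug : (V → ZMod 2) →ₗ[ZMod 2] ZMod 2 := ∑ v, LinearMap.proj v
  have haug : ∀ y, aug y = ∑ v, y v := fun y => by simp [aug]
  have hsurj : Function.Surjective aug := fun a => by
    obtain ⟨v⟩ := ‹Nonempty V›
    exact ⟨Pi.single v a, by rw [haug, Finset.sum_pi_single']; simp⟩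
  have hrange : LinearMap.range ((bdry s).domRestrict (symChains rev)) = LinearMap.ker aug := by
    ext y
    constructor
    · rintro ⟨⟨x, hx⟩, rfl⟩
      rw [LinearMap.mem_ker, haug, LinearMap.domRestrict_apply]
      simp only [bdry, LinearMap.coe_mk, AddHom.coe_mk]
      rw [Finset.sum_comm]
      simp only [Finset.sum_ite_eq, Finset.mem_univ, if_true]
      exact sum_eq_zero_of_mem_symChains rev hrev hne hx
    · intro hy
      rw [LinearMap.mem_ker, haug] at hy
      obtain ⟨v₀⟩ := ‹Nonempty V›
      have hy' : y = ∑ v, y v • (Pi.single v 1 + Pi.single v₀ 1 : V → ZMod 2) := by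
        simp only [smul_add, Finset.sum_add_distrib, ← Finset.sum_smul, hy, zero_smul, add_zero]
        ext w
        simp [Finset.sum_apply, Pi.single_apply]
      rw [hy']
      refine Submodule.sum_mem _ fun v _ => Submodule.smul_mem _ _ ?_
      obtain ⟨x, hx, hb⟩ := exists_chain_of_reflTransGen rev hrev s (hconn v v₀)
      exact ⟨⟨x, hx⟩, hb⟩
  have h1 := LinearMap.finrank_range_add_finrank_ker ((bdry s).domRestrict (symChains rev))
  have h2 := LinearMap.finrank_range_add_finrank_ker aug
  rw [LinearMap.range_eq_top.2 hsurj, finrank_top, Module.finrank_self,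
    Module.finrank_fintype_fun_eq_card] at h2
  rw [hrange] at h1
  unfold cycleSpace
  omega

theorem finrank_range_coboundary [Fintype X] [Fintype V] [Nonempty V] (rev : Equiv.Perm X)
    (hrev : ∀ d, rev (rev d) = d) (s : X → V)
    (hconn : ∀ u v, Relation.ReflTransGen (DartAdj rev s) u v) :
    Module.finrank (ZMod 2) (LinearMap.range (coboundary rev hrev s)) + 1 = Fintype.card V := by
  let κ : ZMod 2 →ₗ[ZMod 2] (V → ZMod 2) := LinearMap.pi fun _ => LinearMap.id
  obtain ⟨v₀⟩ := ‹Nonempty V›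
  have hκ : Function.Injective κ := fun a b h => congrFun h v₀
  have hker : LinearMap.ker (coboundary rev hrev s) = LinearMap.range κ := by
    ext c
    constructor
    · intro hc
      refine ⟨c v₀, ?_⟩
      ext v
      change c v₀ = c v
      induction hconn v₀ v with
      | refl => rfl
      | tail _ hd ih =>
        obtain ⟨d, rfl, rfl⟩ := hd
        rw [ih]
        have := congrFun (congrArg Subtype.val hc) d
        exact CharTwo.add_eq_zero.1 this
    · rintro ⟨a, rfl⟩
      ext d
      exact ZMod2.add_self a
  have h1 := LinearMap.finrank_range_add_finrank_ker (coboundary rev hrev s)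
  rw [hker, LinearMap.finrank_range_of_inj hκ, Module.finrank_self,
    Module.finrank_fintype_fun_eq_card] at h1
  exact h1

/-- Functions of darts which are invariant under `next` have coboundaries which are cycles. -/
theorem add_rev_mem_ker_bdry [Fintype X] (rev next : Equiv.Perm X)
    (s : X → V) (hs : ∀ d, s (next (rev d)) = s d) (b : X → ZMod 2) (hb : ∀ d, b (next d) = b d) :
    bdry s (fun d => b d + b (rev d)) = 0 := by
  classical
  ext v
  simp only [bdry, LinearMap.coe_mk, AddHom.coe_mk, Pi.zero_apply]
  -- Reindex by the rotation `next ∘ rev`, which permutes the darts at each vertex.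
  have h1 : ∑ d, (if s d = v then b d else 0) = ∑ d, if s d = v then b (rev d) else 0 := by
    rw [← Equiv.sum_comp (rev.trans next)]
    exact Finset.sum_congr rfl fun d _ => by
      simp only [Equiv.trans_apply, hs, hb]
  have h2 : ∀ d, (if s d = v then b d + b (rev d) else 0) =
      (if s d = v then b d else 0) + if s d = v then b (rev d) else 0 := fun d => by
    split_ifs <;> simp
  simp only [h2, Finset.sum_add_distrib, h1]
  exact ZMod2.add_self _

theorem range_coboundary_le [Fintype X] {W : Type*} (rev next : Equiv.Perm X)
    (hrev : ∀ d, rev (rev d) = d)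
    (s : X → V) (hs : ∀ d, s (next (rev d)) = s d) (l : X → W) (hl : ∀ d, l (next d) = l d) :
    LinearMap.range (coboundary rev hrev l) ≤ cycleSpace rev s := by
  rintro _ ⟨c, rfl⟩
  exact add_rev_mem_ker_bdry rev next s hs (fun d => c (l d)) fun d => by rw [hl]

/-- A connected map is planar if and only if all its cycles are coboundaries of sets of regions. -/
theorem cycleSpace_eq_range_iff [Fintype X] [Fintype V] [Nonempty V] {W : Type*} [Fintype W]
    [Nonempty W] (rev next : Equiv.Perm X) (hrev : ∀ d, rev (rev d) = d) (hne : ∀ d, rev d ≠ d)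
    (s : X → V) (hs : ∀ d, s (next (rev d)) = s d) (l : X → W) (hl : ∀ d, l (next d) = l d)
    (hconn : ∀ u v, Relation.ReflTransGen (DartAdj rev s) u v)
    (hconn' : ∀ u v, Relation.ReflTransGen (DartAdj rev l) u v) :
    cycleSpace rev s = LinearMap.range (coboundary rev hrev l) ↔
      Fintype.card V + Fintype.card W = Fintype.card X / 2 + 2 := by
  -- Coboundaries of sets of regions are always cycles, so equality is a comparison of dimensions.
  have h0 := two_mul_finrank_symChains rev hrev hne
  have h1 := finrank_cycleSpace rev hrev hne s hconn
  have h2 := finrank_range_coboundary rev hrev l hconn'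
  constructor
  · intro h
    rw [h] at h1
    omega
  · intro h
    refine (Submodule.eq_of_le_of_finrank_eq (range_coboundary_le rev next hrev s hs l hl) ?_).symm
    omega

end ChainComplex

/-! ### Submaps carried by sets of faces, with rotation given by first return. -/

/-- The first return map of a permutation to a subset. -/
theorem Equiv.Perm.exists_firstReturn {X : Type*} [Finite X] (ρ : Equiv.Perm X) (P : X → Prop) :
    ∃ σ : Equiv.Perm {x // P x}, (∀ a : {x // P x}, P (ρ a) → (σ a : X) = ρ a) ∧
      ∀ a b, σ.SameCycle a b ↔ ρ.SameCycle (a : X) b := by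
  classical
  have hex : ∀ a : {x // P x}, ∃ n : ℕ, P ((ρ ^ (n + 1)) a) := fun a => by
    refine ⟨orderOf ρ - 1, ?_⟩
    rw [Nat.sub_add_cancel (orderOf_pos ρ), pow_orderOf_eq_one]
    exact a.2
  let n : {x // P x} → ℕ := fun a => Nat.find (hex a)
  have hn : ∀ a, P ((ρ ^ (n a + 1)) a) := fun a => Nat.find_spec (hex a)
  have hmin : ∀ (a : {x // P x}) (m : ℕ), 0 < m → P ((ρ ^ m) a) → n a + 1 ≤ m := fun a m hm h => by
    obtain ⟨k, rfl⟩ := Nat.exists_eq_succ_of_ne_zero hm.ne'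
    exact Nat.succ_le_succ (Nat.find_min' (hex a) h)
  let f : {x // P x} → {x // P x} := fun a => ⟨(ρ ^ (n a + 1)) a, hn a⟩
  -- If two points share their first return, the orbit of the later one meets the other before
  -- returning, against minimality.
  have hinj' : ∀ a b, n a ≤ n b → f a = f b → a = b := fun a b hab h => by
    have h' : (ρ ^ (n a + 1)) (a : X) = (ρ ^ (n b + 1)) b := congrArg Subtype.val h
    have h3 : (a : X) = (ρ ^ (n b - n a)) b := by
      apply (ρ ^ (n a + 1)).injective
      rw [h', ← Equiv.Perm.mul_apply, ← pow_add]
      congr 2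
      omega
    rcases Nat.eq_zero_or_pos (n b - n a) with h0 | h0
    · rw [h0] at h3
      exact Subtype.ext h3
    · have := hmin b _ h0 (h3 ▸ a.2)
      omega
  have hinj : Function.Injective f := fun a b h => by
    rcases le_total (n a) (n b) with hab | hab
    · exact hinj' a b hab h
    · exact (hinj' b a hab h.symm).symm
  let σ : Equiv.Perm {x // P x} := Equiv.ofBijective f (Finite.injective_iff_bijective.1 hinj)
  have hσ : ∀ a, (σ a : X) = (ρ ^ (n a + 1)) a := fun a => rfl
  refine ⟨σ, fun a h => ?_, fun a b => ⟨?_, ?_⟩⟩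
  · have := hmin a 1 one_pos (by simpa using h)
    rw [hσ, show n a = 0 by omega]
    simp
  · intro h
    obtain ⟨i, hi⟩ := h.exists_nat_pow_eq
    rw [← hi]
    clear hi
    induction i with
    | zero => exact Equiv.Perm.SameCycle.refl _ _
    | succ i ih =>
      rw [pow_succ', Equiv.Perm.mul_apply, hσ]
      exact (Equiv.Perm.sameCycle_pow_right).2 ih
  · intro h
    obtain ⟨i, hi⟩ := h.exists_nat_pow_eq
    induction i using Nat.strong_induction_on generalizing a with
    | _ i ih =>
      rcases Nat.eq_zero_or_pos i with rfl | h0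
      · rw [Subtype.ext (a1 := a) (a2 := b) hi]
      · have hle := hmin a i h0 (hi ▸ b.2)
        have : (ρ ^ (i - (n a + 1))) (σ a : X) = b := by
          rw [hσ, ← Equiv.Perm.mul_apply, ← pow_add, Nat.sub_add_cancel hle, hi]
        exact Equiv.Perm.sameCycle_apply_left.1
          (ih _ (by omega) (σ a) ⟨((i - (n a + 1) : ℕ) : ℤ), by rw [zpow_natCast, this]⟩ this)

namespace DiscMap

variable (D : DiscMap)

noncomputable instance : Fintype D.Vertex := @Fintype.ofFinite _ D.finite_vertex
noncomputable instance : Fintype D.Dart := @Fintype.ofFinite _ D.finite_dart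
noncomputable instance : Fintype D.Face := @Fintype.ofFinite _ D.finite_face
instance : Nonempty D.Vertex := D.nonempty_vertex

theorem left_next (d : D.Dart) : D.left (D.next d) = D.left d :=
  (D.left_eq_iff _ _).2 (Equiv.Perm.sameCycle_apply_left.2 (Equiv.Perm.SameCycle.refl _ _))

theorem src_next_rev (d : D.Dart) : D.src (D.next (D.rev d)) = D.src d :=
  (D.src_eq_iff _ _).2 (Equiv.Perm.sameCycle_apply_left (f := D.next * D.rev).2
    (Equiv.Perm.SameCycle.refl _ _))

theorem src_next (d : D.Dart) : D.src (D.next d) = D.src (D.rev d) := by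
  rw [← D.src_next_rev (D.rev d), D.rev_rev]

theorem left_next_iterate (d : D.Dart) (n : ℕ) : D.left (D.next^[n] d) = D.left d := by
  induction n with
  | zero => rfl
  | succ n ih => rw [Function.iterate_succ_apply', left_next, ih]

/-- Turning around a vertex crosses one edge at a time, so a path of edges yields a path of adjacent
regions. -/
theorem dual_connected (u v : Option D.Face) :
    Relation.ReflTransGen (DartAdj D.rev D.left) u v := by
  have hcyc : ∀ d e, D.src d = D.src e →
      Relation.ReflTransGen (DartAdj D.rev D.left) (D.left d) (D.left e) := fun d e h => by
    obtain ⟨n, rfl⟩ := ((D.src_eq_iff d e).1 h).exists_nat_pow_eq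
    clear h
    induction n with
    | zero => exact .refl
    | succ n ih =>
      refine ih.tail ⟨((D.next * D.rev) ^ n) d, rfl, ?_⟩
      rw [pow_succ', Equiv.Perm.mul_apply, Equiv.Perm.mul_apply, left_next]
  have hdart : ∀ d w, Relation.ReflTransGen (fun a b => ∃ d, D.src d = a ∧ D.src (D.rev d) = b)
      (D.src d) w → ∀ e, D.src e = w →
      Relation.ReflTransGen (DartAdj D.rev D.left) (D.left d) (D.left e) := fun d w h => by
    induction h with
    | refl => exact fun e he => hcyc d e he.symm
    | tail _ ha ih =>
      obtain ⟨a, rfl, rfl⟩ := ha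
      exact fun e he => ((ih a rfl).tail ⟨a, rfl, rfl⟩).trans (hcyc _ _ he.symm)
  rcases isEmpty_or_nonempty D.Dart with hD | hD
  · have hF : ∀ w : Option D.Face, w = none := fun w => by
      cases w with
      | none => rfl
      | some f => exact hD.elim (D.exists_left_eq_some f).choose
    rw [hF u, hF v]
  · have hex : ∀ w : Option D.Face, ∃ d, D.left d = w := fun w => by
      cases w with
      | none => exact D.exists_left_eq_none hD
      | some f => exact D.exists_left_eq_some f
    obtain ⟨d, rfl⟩ := hex u
    obtain ⟨e, rfl⟩ := hex v
    exact hdart d _ (D.connected _ _) e rfl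

theorem cycleSpace_eq_range :
    cycleSpace D.rev D.src = LinearMap.range (coboundary D.rev D.rev_rev D.left) := by
  rw [cycleSpace_eq_range_iff D.rev D.next D.rev_rev D.rev_ne D.src D.src_next_rev D.left
    D.left_next D.connected D.dual_connected]
  have := D.euler
  rw [Nat.card_eq_fintype_card, Nat.card_eq_fintype_card, Nat.card_eq_fintype_card] at this
  rw [Fintype.card_option]
  omega

/-- In a disc, every mod 2 cycle bounds. -/
theorem exists_coboundary {x : D.Dart → ZMod 2} (hx : x ∈ symChains D.rev)
    (hb : bdry D.src x = 0) :
    ∃ c : Option D.Face → ZMod 2, ∀ d, x d = c (D.left d) + c (D.left (D.rev d)) := by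
  have : (⟨x, hx⟩ : symChains D.rev) ∈ cycleSpace D.rev D.src := hb
  rw [cycleSpace_eq_range] at this
  obtain ⟨c, hc⟩ := this
  exact ⟨c, fun d => (congrFun (congrArg Subtype.val hc) d).symm⟩

/-- The face to the left of `d` exists and belongs to `A`. -/
def InSet (A : Set D.Face) (d : D.Dart) : Prop := ∃ f ∈ A, D.left d = some f

/-- Two faces sharing an edge. -/
def FaceAdj (f g : D.Face) : Prop := ∃ d, D.left d = some f ∧ D.left (D.rev d) = some g

/-- Adjacency of faces within a set of faces. -/
def AdjIn (A : Set D.Face) (f g : D.Face) : Prop := f ∈ A ∧ g ∈ A ∧ D.FaceAdj f g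

/-- Any two faces are joined by a path of faces crossing interior edges only. -/
def InnerConnected : Prop := ∀ f g, Relation.ReflTransGen D.FaceAdj f g

/-- The outer region can be reached from the face `f` through faces of `T`. -/
inductive OuterReach (T : Set D.Face) : D.Face → Prop
  | base (d : D.Dart) (f : D.Face) : f ∈ T → D.left d = some f → D.left (D.rev d) = none →
      OuterReach T f
  | step (d : D.Dart) (f g : D.Face) : f ∈ T → D.left d = some f → D.left (D.rev d) = some g →
      OuterReach T g → OuterReach T f

/-- The complement of `A`, with the outer region added, is connected. -/
def Cosimple (A : Set D.Face) : Prop := ∀ f ∉ A, D.OuterReach Aᶜ f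

/-- The number of edges separating `A` from its complement. -/
noncomputable def cutLength (A : Set D.Face) : ℕ :=
  Nat.card {d : D.Dart // D.InSet A d ∧ ¬ D.InSet A (D.rev d)}

variable {D} {A : Set D.Face}

theorem inSet_next {d : D.Dart} : D.InSet A (D.next d) ↔ D.InSet A d := by
  rw [InSet, InSet, left_next]

theorem exists_boundary_dart (hA : A.Nonempty) :
    ∃ d, D.InSet A d ∧ ¬ D.InSet A (D.rev d) := by
  by_contra! h
  obtain ⟨f, hf⟩ := hA
  have : ∀ w, Relation.ReflTransGen (DartAdj D.rev D.left) (some f) w →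
      ∃ g ∈ A, w = some g := fun w hw => by
    induction hw with
    | refl => exact ⟨f, hf, rfl⟩
    | tail _ hd ih =>
      obtain ⟨d, rfl, rfl⟩ := hd
      exact h d ih
  obtain ⟨g, _, hg⟩ := this none (D.dual_connected _ _)
  exact absurd hg (Option.some_ne_none g).symm

variable (D A)

/-- The darts of the submap carried by a set of faces. -/
abbrev SubDart := {d : D.Dart // D.InSet A d ∨ D.InSet A (D.rev d)}

/-- The vertices of the submap carried by a set of faces. -/
abbrev SubVertex := {v : D.Vertex // ∃ d : D.SubDart A, D.src d = v}

open Classical in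
noncomputable instance : Fintype (D.SubDart A) := Subtype.fintype _

open Classical in
noncomputable instance : Fintype (D.SubVertex A) := Subtype.fintype _

/-- Reversal of the darts of a submap. -/
def subRev : Equiv.Perm (D.SubDart A) :=
  D.rev.subtypePerm fun d => by rw [D.rev_rev, or_comm]

/-- The rotation of a submap. -/
noncomputable def subRot : Equiv.Perm (D.SubDart A) :=
  (Equiv.Perm.exists_firstReturn (D.next * D.rev)
    fun d => D.InSet A d ∨ D.InSet A (D.rev d)).choose

/-- The successor map on the region cycles of a submap. -/
noncomputable def subNext : Equiv.Perm (D.SubDart A) := D.subRot A * D.subRev A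

/-- The starting vertex of a dart of a submap. -/
def subSrc (d : D.SubDart A) : D.SubVertex A := ⟨D.src d, d, rfl⟩

open Classical in
/-- The region to the left of a dart, the faces outside `A` being merged with the outer region. -/
noncomputable def subLeft (d : D.Dart) : Option A :=
  if h : D.InSet A d then some ⟨h.choose, h.choose_spec.1⟩ else none

variable {D A}

theorem subLeft_eq_some {d : D.Dart} {f : A} : D.subLeft A d = some f ↔ D.left d = some f.1 := by
  unfold subLeft
  split_ifs with h
  · have := h.choose_spec.2
    rw [Option.some_inj, Subtype.ext_iff]
    exact ⟨fun h' => this.trans (congrArg some h'), fun h' => Option.some_inj.1 (this.symm.trans h')⟩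
  · refine ⟨fun h' => by simp at h', fun h' => (h ⟨f, f.2, h'⟩).elim⟩

theorem subLeft_eq_none {d : D.Dart} : D.subLeft A d = none ↔ ¬ D.InSet A d := by
  unfold subLeft
  split_ifs with h <;> simp [h]

theorem subRev_coe (d : D.SubDart A) : (D.subRev A d : D.Dart) = D.rev d := rfl

theorem subRev_subRev (d : D.SubDart A) : D.subRev A (D.subRev A d) = d :=
  Subtype.ext (D.rev_rev d)

theorem subRev_ne (d : D.SubDart A) : D.subRev A d ≠ d :=
  fun h => D.rev_ne d (congrArg Subtype.val h)

theorem subNext_mul_subRev : D.subNext A * D.subRev A = D.subRot A := by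
  ext1 d
  simp only [subNext, Equiv.Perm.mul_apply, subRev_subRev]

theorem subNext_coe (d : D.SubDart A) (h : D.InSet A d) :
    (D.subNext A d : D.Dart) = D.next d := by
  have h1 : (D.next * D.rev) (D.subRev A d : D.Dart) = D.next d := by
    rw [subRev_coe, Equiv.Perm.mul_apply, D.rev_rev]
  have := (Equiv.Perm.exists_firstReturn (D.next * D.rev)
    fun d => D.InSet A d ∨ D.InSet A (D.rev d)).choose_spec.1 (D.subRev A d)
    (by rw [h1]; exact Or.inl (inSet_next.2 h))
  rwa [h1] at this

theorem subSrc_eq_iff (d e : D.SubDart A) :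
    D.subSrc A d = D.subSrc A e ↔ (D.subNext A * D.subRev A).SameCycle d e := by
  rw [subNext_mul_subRev]
  have := (Equiv.Perm.exists_firstReturn (D.next * D.rev)
    fun d => D.InSet A d ∨ D.InSet A (D.rev d)).choose_spec.2 d e
  rw [subRot, this, ← D.src_eq_iff, Subtype.ext_iff]
  rfl

theorem subSrc_subNext_subRev (d : D.SubDart A) :
    D.subSrc A (D.subNext A (D.subRev A d)) = D.subSrc A d :=
  (subSrc_eq_iff _ _).2 (Equiv.Perm.sameCycle_apply_left (f := D.subNext A * D.subRev A).2
    (Equiv.Perm.SameCycle.refl _ _))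

theorem inSet_subNext (d : D.SubDart A) : D.InSet A (D.subNext A d) ↔ D.InSet A d := by
  constructor
  · intro h
    have h1 : D.InSet A (D.next.symm (D.subNext A d)) := by
      rw [← inSet_next, Equiv.apply_symm_apply]
      exact h
    have h2 : D.subNext A ⟨_, Or.inl h1⟩ = D.subNext A d :=
      Subtype.ext (by rw [subNext_coe _ h1, Equiv.apply_symm_apply])
    rw [← (D.subNext A).injective h2]
    exact h1
  · intro h
    rw [subNext_coe d h]
    exact inSet_next.2 h

theorem subLeft_subNext (d : D.SubDart A) :
    D.subLeft A (D.subNext A d) = D.subLeft A d := by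
  by_cases h : D.InSet A d
  · obtain ⟨f, hf, hd⟩ := h
    rw [subLeft_eq_some (f := ⟨f, hf⟩) |>.2 hd, subLeft_eq_some, subNext_coe _ ⟨f, hf, hd⟩,
      left_next, hd]
  · rw [subLeft_eq_none.2 h, subLeft_eq_none, inSet_subNext]
    exact h

theorem subNext_iterate_coe (d : D.SubDart A) (h : D.InSet A d) (n : ℕ) :
    ((D.subNext A)^[n] d : D.Dart) = D.next^[n] d := by
  induction n with
  | zero => rfl
  | succ n ih =>
    have h' : D.InSet A ((D.subNext A)^[n] d : D.Dart) := by
      rw [ih, InSet, left_next_iterate]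
      exact h
    rw [Function.iterate_succ_apply', Function.iterate_succ_apply', subNext_coe _ h', ih]

/-- Extended by zero, the cycle bounds in `D`. The resulting function of the regions does not jump
across edges outside the submap, so by cosimplicity it takes its outer value on every face outside
`A` and descends to the merged regions. -/
theorem exists_sub_coboundary (hout : D.Cosimple A) {x : D.SubDart A → ZMod 2}
    (hx : x ∈ symChains (D.subRev A)) (hb : bdry (D.subSrc A) x = 0) :
    ∃ c : Option A → ZMod 2, ∀ d : D.SubDart A,
      x d = c (D.subLeft A d) + c (D.subLeft A (D.subRev A d)) := by
  classical
  let y : D.Dart → ZMod 2 := fun d =>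
    if h : D.InSet A d ∨ D.InSet A (D.rev d) then x ⟨d, h⟩ else 0
  have hyx : ∀ d : D.SubDart A, y d = x d := fun d => dif_pos d.2
  have hy0 : ∀ d, ¬ (D.InSet A d ∨ D.InSet A (D.rev d)) → y d = 0 := fun d h => dif_neg h
  have hy : y ∈ symChains D.rev := fun d => by
    by_cases h : D.InSet A d ∨ D.InSet A (D.rev d)
    · have := hx ⟨d, h⟩
      rw [← hyx, ← hyx] at this
      exact this
    · rw [hy0 d h, hy0 (D.rev d) (by rwa [D.rev_rev, or_comm])]
  have hyb : bdry D.src y = 0 := by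
    ext v
    have hsum : bdry D.src y v = ∑ d : D.SubDart A, if D.src d = v then x d else 0 := by
      simp only [bdry, LinearMap.coe_mk, AddHom.coe_mk]
      rw [← Fintype.sum_subtype_add_sum_subtype (fun d => D.InSet A d ∨ D.InSet A (D.rev d))]
      simp only [hyx]
      rw [add_eq_left]
      exact Finset.sum_eq_zero fun d _ => by rw [hy0 d d.2, ite_self]
    rw [hsum, Pi.zero_apply]
    by_cases hv : ∃ d : D.SubDart A, D.src d = v
    · have := congrFun hb ⟨v, hv⟩
      simp only [bdry, LinearMap.coe_mk, AddHom.coe_mk, subSrc, Subtype.mk.injEq] at this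
      exact this
    · exact Finset.sum_eq_zero fun d _ => if_neg fun h => hv ⟨d, h⟩
  obtain ⟨c, hc⟩ := D.exists_coboundary hy hyb
  have hreach : ∀ f, D.OuterReach Aᶜ f → c (some f) = c none := fun f hf => by
    induction hf with
    | base d f hf h1 h2 =>
      have := hc d
      rw [h1, h2, hy0 d (by simpa [InSet, h1, h2] using hf)] at this
      exact CharTwo.add_eq_zero.1 this.symm
    | step d f g hf h1 h2 hg ih =>
      have hgA : g ∈ Aᶜ := by cases hg <;> assumption
      have := hc d
      rw [h1, h2, hy0 d (by rw [InSet, InSet, h1, h2]; simpa using ⟨hf, hgA⟩)] at this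
      rw [← ih]
      exact CharTwo.add_eq_zero.1 this.symm
  refine ⟨fun w => c (w.map Subtype.val), fun d => ?_⟩
  have key : ∀ e : D.Dart, c (D.left e) = c ((D.subLeft A e).map Subtype.val) := fun e => by
    cases hs : D.subLeft A e with
    | some f => rw [subLeft_eq_some.1 hs]; rfl
    | none =>
      rw [subLeft_eq_none] at hs
      cases hl : D.left e with
      | none => rfl
      | some f => exact hreach f (hout f fun hf => hs ⟨f, hf, hl⟩)
  rw [← hyx, hc, key, key]
  rfl

/-- The point is that the merged outer region has a single boundary cycle. The indicator of one of
its cycles has a coboundary which is a mod 2 cycle, hence comes from a function of the regions. That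
function is constant on the connected set `A`, so the indicator is constant on all outer darts. -/
theorem subLeft_eq_iff (hconn : ∀ f ∈ A, ∀ g ∈ A, Relation.ReflTransGen (D.AdjIn A) f g)
    (hout : D.Cosimple A) (d e : D.SubDart A) :
    D.subLeft A d = D.subLeft A e ↔ (D.subNext A).SameCycle d e := by
  classical
  have hsame : ∀ d e : D.SubDart A, (D.subNext A).SameCycle d e →
      D.subLeft A d = D.subLeft A e := fun d e h => by
    obtain ⟨n, rfl⟩ := h.exists_nat_pow_eq
    clear h
    induction n with
    | zero => rfl
    | succ n ih => rw [pow_succ', Equiv.Perm.mul_apply, subLeft_subNext, ih]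
  refine ⟨fun h => ?_, hsame d e⟩
  by_cases hd : D.InSet A d
  · obtain ⟨f, hf, hdf⟩ := hd
    rw [subLeft_eq_some (f := ⟨f, hf⟩) |>.2 hdf, eq_comm, subLeft_eq_some] at h
    obtain ⟨n, hn⟩ := ((D.left_eq_iff d e).1 (hdf.trans h.symm)).exists_nat_pow_eq
    refine ⟨n, ?_⟩
    rw [zpow_natCast, ← Equiv.Perm.iterate_eq_pow]
    refine Subtype.ext ?_
    rw [subNext_iterate_coe d ⟨f, hf, hdf⟩, Equiv.Perm.iterate_eq_pow, hn]
  · have he : ¬ D.InSet A e := by rwa [← subLeft_eq_none, ← h, subLeft_eq_none]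
    let b : D.SubDart A → ZMod 2 := fun a => if (D.subNext A).SameCycle d a then 1 else 0
    have hb0 : ∀ a : D.SubDart A, D.InSet A a → b a = 0 := fun a ha => if_neg fun hda =>
      subLeft_eq_none.1 ((hsame d a hda).symm.trans (subLeft_eq_none.2 hd)) ha
    have hbn : ∀ a, b (D.subNext A a) = b a := fun a => by
      simp only [b, Equiv.Perm.sameCycle_apply_right]
    obtain ⟨c, hc⟩ := exists_sub_coboundary hout
      (x := fun a => b a + b (D.subRev A a))
      (fun a => by simp only [subRev_subRev, add_comm])
      (add_rev_mem_ker_bdry (D.subRev A) (D.subNext A) (D.subSrc A) subSrc_subNext_subRev b hbn)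
    have hcA : ∀ f g : A, c (some f) = c (some g) := fun f g => by
      have : ∀ g, Relation.ReflTransGen (D.AdjIn A) f g → ∀ hg : g ∈ A,
          c (some f) = c (some ⟨g, hg⟩) := fun g h => by
        induction h with
        | refl => exact fun _ => rfl
        | @tail g k _ hk ih =>
          intro hkA
          obtain ⟨hg, _, a, h1, h2⟩ := hk
          rw [ih hg]
          have hin : D.InSet A a := ⟨g, hg, h1⟩
          have hin' : D.InSet A (D.rev a) := ⟨k, hkA, h2⟩
          have := hc ⟨a, Or.inl hin⟩
          rw [hb0 ⟨a, Or.inl hin⟩ hin, hb0 (D.subRev A ⟨a, Or.inl hin⟩) hin',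
            subLeft_eq_some (f := ⟨g, hg⟩) |>.2 h1,
            subRev_coe, subLeft_eq_some (f := ⟨k, hkA⟩) |>.2 h2, add_zero] at this
          exact CharTwo.add_eq_zero.1 this.symm
      exact this g (hconn f f.2 g g.2) g.2
    have hval : ∀ a : D.SubDart A, ¬ D.InSet A a → ∃ f : A, b a = c none + c (some f) :=
      fun a ha => by
        obtain ⟨f, hf, hl⟩ := a.2.resolve_left ha
        have := hc a
        rw [subLeft_eq_none.2 ha, subRev_coe, subLeft_eq_some (f := ⟨f, hf⟩) |>.2 hl,
          hb0 (D.subRev A a) ⟨f, hf, hl⟩, add_zero] at this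
        exact ⟨_, this⟩
    obtain ⟨f, hf⟩ := hval d hd
    obtain ⟨g, hg⟩ := hval e he
    have hbe : b e = b d := by rw [hf, hg, hcA f g]
    by_contra hde
    have h1 : b d = 1 := if_pos (Equiv.Perm.SameCycle.refl _ _)
    have h2 : b e = 0 := if_neg hde
    rw [h1, h2] at hbe
    exact zero_ne_one hbe

theorem sub_connected (hconn : ∀ f ∈ A, ∀ g ∈ A, Relation.ReflTransGen (D.AdjIn A) f g)
    (u v : D.SubVertex A) :
    Relation.ReflTransGen (DartAdj (D.subRev A) (D.subSrc A)) u v := by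
  have hface : ∀ d e : D.SubDart A, D.InSet A d → D.left d = D.left e →
      Relation.ReflTransGen (DartAdj (D.subRev A) (D.subSrc A)) (D.subSrc A d) (D.subSrc A e) :=
    fun d e hd h => by
      obtain ⟨n, hn⟩ := ((D.left_eq_iff d e).1 h).exists_nat_pow_eq
      have : e = (D.subNext A)^[n] d := by
        refine Subtype.ext ?_
        rw [subNext_iterate_coe d hd, Equiv.Perm.iterate_eq_pow, hn]
      rw [this]
      clear hn h this
      induction n with
      | zero => exact .refl
      | succ n ih =>
        refine ih.tail ⟨_, rfl, ?_⟩
        rw [Function.iterate_succ_apply']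
        have := subSrc_subNext_subRev (D.subRev A ((D.subNext A)^[n] d))
        rw [subRev_subRev] at this
        exact this.symm
  have hpath : ∀ f g, Relation.ReflTransGen (D.AdjIn A) f g → f ∈ A → ∀ d e : D.SubDart A,
      D.left d = some f → D.left e = some g →
      Relation.ReflTransGen (DartAdj (D.subRev A) (D.subSrc A)) (D.subSrc A d) (D.subSrc A e) :=
    fun f g h hf d => by
      induction h with
      | refl => exact fun e h1 h2 => hface d e ⟨f, hf, h1⟩ (h1.trans h2.symm)
      | @tail g k _ hk ih =>
        intro e h1 h2
        obtain ⟨hg, hk, a, h3, h4⟩ := hk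
        let a' : D.SubDart A := ⟨a, Or.inl ⟨g, hg, h3⟩⟩
        exact ((ih a' h1 h3).tail ⟨a', rfl, rfl⟩).trans
          (hface (D.subRev A a') e ⟨k, hk, h4⟩ (h4.trans h2.symm))
  have hin : ∀ u : D.SubVertex A, ∃ d : D.SubDart A, D.InSet A d ∧
      Relation.ReflTransGen (DartAdj (D.subRev A) (D.subSrc A)) u (D.subSrc A d) ∧
      Relation.ReflTransGen (DartAdj (D.subRev A) (D.subSrc A)) (D.subSrc A d) u :=
    fun u => by
      obtain ⟨u, d, rfl⟩ := u
      by_cases hd : D.InSet A d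
      · exact ⟨d, hd, .refl, .refl⟩
      · exact ⟨D.subRev A d, d.2.resolve_left hd, .single ⟨d, rfl, rfl⟩,
          .single ⟨D.subRev A d, rfl, by rw [subRev_subRev]; rfl⟩⟩
  obtain ⟨d, ⟨f, hf, hd⟩, hu, _⟩ := hin u
  obtain ⟨e, ⟨g, hg, he⟩, _, hv⟩ := hin v
  exact (hu.trans (hpath f g (hconn f hf g hg) hf d e hd he)).trans hv

theorem sub_dual_connected (hA : A.Nonempty)
    (hconn : ∀ f ∈ A, ∀ g ∈ A, Relation.ReflTransGen (D.AdjIn A) f g) (u v : Option A) :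
    Relation.ReflTransGen (DartAdj (D.subRev A) fun d => D.subLeft A d) u v := by
  have hAA : ∀ f g : A,
      Relation.ReflTransGen (DartAdj (D.subRev A) fun d => D.subLeft A d) (some f) (some g) :=
    fun f g => by
      have : ∀ g, Relation.ReflTransGen (D.AdjIn A) f g → ∀ hg : g ∈ A,
          Relation.ReflTransGen (DartAdj (D.subRev A) fun d => D.subLeft A d) (some f)
            (some ⟨g, hg⟩) := fun g h => by
        induction h with
        | refl => exact fun _ => .refl
        | @tail g k _ hk ih =>
          intro hkA
          obtain ⟨hg, _, a, h1, h2⟩ := hk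
          exact (ih hg).tail ⟨⟨a, Or.inl ⟨g, hg, h1⟩⟩, subLeft_eq_some.2 h1, subLeft_eq_some.2 h2⟩
      exact this g (hconn f f.2 g g.2) g.2
  obtain ⟨d, ⟨f, hf, hd⟩, hd'⟩ := exists_boundary_dart hA
  let a : D.SubDart A := ⟨d, Or.inl ⟨f, hf, hd⟩⟩
  have h1 : D.subLeft A a = some ⟨f, hf⟩ := subLeft_eq_some.2 hd
  have h2 : D.subLeft A (D.subRev A a) = none := subLeft_eq_none.2 hd'
  have hin : Relation.ReflTransGen (DartAdj (D.subRev A) fun d => D.subLeft A d) none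
      (some ⟨f, hf⟩) := .single ⟨D.subRev A a, h2, by rw [subRev_subRev]; exact h1⟩
  have hex : Relation.ReflTransGen (DartAdj (D.subRev A) fun d => D.subLeft A d)
      (some ⟨f, hf⟩) none := .single ⟨a, h1, h2⟩
  match u, v with
  | none, none => exact .refl
  | none, some g => exact hin.trans (hAA _ g)
  | some g, none => exact (hAA g _).trans hex
  | some f, some g => exact hAA f g

/-- The submap carried by a connected set of faces with connected complement. -/
noncomputable def subMap (hA : A.Nonempty)
    (hconn : ∀ f ∈ A, ∀ g ∈ A, Relation.ReflTransGen (D.AdjIn A) f g) (hout : D.Cosimple A) :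
    DiscMap where
  Vertex := D.SubVertex A
  Dart := D.SubDart A
  Face := A
  finite_vertex := inferInstance
  finite_dart := inferInstance
  finite_face := inferInstance
  rev := D.subRev A
  rev_rev := subRev_subRev
  rev_ne := subRev_ne
  next := D.subNext A
  src := D.subSrc A
  left d := D.subLeft A d
  src_eq_iff := subSrc_eq_iff
  left_eq_iff := subLeft_eq_iff hconn hout
  exists_left_eq_some f := by
    obtain ⟨d, hd⟩ := D.exists_left_eq_some f
    exact ⟨⟨d, Or.inl ⟨f, f.2, hd⟩⟩, subLeft_eq_some.2 hd⟩
  exists_left_eq_none _ := by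
    obtain ⟨d, hd, hd'⟩ := exists_boundary_dart hA
    exact ⟨⟨D.rev d, Or.inr (by rwa [D.rev_rev])⟩, subLeft_eq_none.2 hd'⟩
  nonempty_vertex := by
    obtain ⟨d, hd, _⟩ := exists_boundary_dart hA
    exact ⟨D.subSrc A ⟨d, Or.inl hd⟩⟩
  connected := sub_connected hconn
  euler := by
    classical
    have : Nonempty (D.SubVertex A) := by
      obtain ⟨d, hd, _⟩ := exists_boundary_dart hA
      exact ⟨D.subSrc A ⟨d, Or.inl hd⟩⟩
    -- Euler's formula is obtained from the bounding of cycles.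
    have hle := range_coboundary_le (D.subRev A) (D.subNext A) subRev_subRev (D.subSrc A)
      subSrc_subNext_subRev (fun d => D.subLeft A d) subLeft_subNext
    have h := (cycleSpace_eq_range_iff (D.subRev A) (D.subNext A) subRev_subRev subRev_ne
      (D.subSrc A) subSrc_subNext_subRev (fun d => D.subLeft A d) subLeft_subNext
      (sub_connected hconn) (sub_dual_connected hA hconn)).1 (le_antisymm (fun x hx => by
        obtain ⟨c, hc⟩ := exists_sub_coboundary hout x.2 hx
        exact ⟨c, Subtype.ext (funext fun d => (hc d).symm)⟩) hle)
    rw [Fintype.card_option] at h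
    rw [Nat.card_eq_fintype_card, Nat.card_eq_fintype_card, Nat.card_eq_fintype_card]
    omega

theorem subMap_regionLength (hA : A.Nonempty)
    (hconn : ∀ f ∈ A, ∀ g ∈ A, Relation.ReflTransGen (D.AdjIn A) f g) (hout : D.Cosimple A)
    (f : A) : (subMap hA hconn hout).regionLength (some f) = D.regionLength (some f.1) :=
  Nat.card_congr
    { toFun := fun d => ⟨d.1.1, subLeft_eq_some.1 d.2⟩
      invFun := fun d => ⟨⟨d.1, Or.inl ⟨f, f.2, d.2⟩⟩, subLeft_eq_some.2 d.2⟩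
      left_inv := fun _ => rfl
      right_inv := fun _ => rfl }

theorem subMap_boundaryLength (hA : A.Nonempty)
    (hconn : ∀ f ∈ A, ∀ g ∈ A, Relation.ReflTransGen (D.AdjIn A) f g) (hout : D.Cosimple A) :
    (subMap hA hconn hout).boundaryLength = D.cutLength A :=
  Nat.card_congr
    { toFun := fun d => ⟨D.rev d.1.1, d.1.2.resolve_left (subLeft_eq_none.1 d.2), by
        rw [D.rev_rev]; exact subLeft_eq_none.1 d.2⟩
      invFun := fun d => ⟨⟨D.rev d.1, Or.inr (by rw [D.rev_rev]; exact d.2.1)⟩,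
        subLeft_eq_none.2 d.2.2⟩
      left_inv := fun d => Subtype.ext (Subtype.ext (D.rev_rev _))
      right_inv := fun d => Subtype.ext (D.rev_rev _) }

theorem subMap_innerConnected (hA : A.Nonempty)
    (hconn : ∀ f ∈ A, ∀ g ∈ A, Relation.ReflTransGen (D.AdjIn A) f g) (hout : D.Cosimple A) :
    (subMap hA hconn hout).InnerConnected := fun f g => by
  have : ∀ g, Relation.ReflTransGen (D.AdjIn A) f.1 g → ∀ hg : g ∈ A,
      Relation.ReflTransGen (subMap hA hconn hout).FaceAdj f ⟨g, hg⟩ := fun g h => by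
    induction h with
    | refl => exact fun _ => .refl
    | @tail g k _ hk ih =>
      intro hkA
      obtain ⟨hg, _, a, h1, h2⟩ := hk
      exact (ih hg).tail ⟨⟨a, Or.inl ⟨g, hg, h1⟩⟩, subLeft_eq_some.2 h1, subLeft_eq_some.2 h2⟩
  exact this g.1 (hconn f.1 f.2 g.1 g.2) g.2

theorem _root_.List.map_iterate_of_forall {X Y : Type*} (g : X → Y) (f : X → X) (f' : Y → Y) (a : X)
    (n : ℕ) (h : ∀ k, g (f^[k] a) = f'^[k] (g a)) :
    (List.iterate f a n).map g = List.iterate f' (g a) n := by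
  refine List.ext_getElem (by simp) fun k h1 h2 => ?_
  rw [List.getElem_map, List.getElem_iterate, List.getElem_iterate, h]

theorem subMap_boundaryCycle (hA : A.Nonempty)
    (hconn : ∀ f ∈ A, ∀ g ∈ A, Relation.ReflTransGen (D.AdjIn A) f g) (hout : D.Cosimple A)
    (d : D.SubDart A) (hd : D.InSet A d) :
    ((subMap hA hconn hout).boundaryCycle d).map (fun e : D.SubDart A => (e : D.Dart)) =
      D.boundaryCycle d := by
  obtain ⟨f, hf, hl⟩ := hd
  have h1 : (subMap hA hconn hout).left d = some ⟨f, hf⟩ := subLeft_eq_some.2 hl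
  unfold boundaryCycle
  rw [h1, subMap_regionLength, hl]
  exact List.map_iterate_of_forall (fun e : D.SubDart A => (e : D.Dart)) (D.subNext A) D.next d _
    (subNext_iterate_coe d ⟨f, hf, hl⟩)

end DiscMap

/-! ### Subdiagrams of reduced van Kampen diagrams. -/

namespace VanKampenDiagram

variable {α : Type*} {R : Set (List (α × Bool))}

/-- A connected set of faces with connected complement carries a van Kampen diagram. -/
theorem exists_subdiagram (D : VanKampenDiagram R) (hD : D.IsReduced) {A : Set D.Face}
    (hA : A.Nonempty) (hconn : ∀ f ∈ A, ∀ g ∈ A, Relation.ReflTransGen (D.AdjIn A) f g)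
    (hout : D.Cosimple A) :
    ∃ D' : VanKampenDiagram R, D'.IsReduced ∧ D'.InnerConnected ∧ D'.numFaces = A.ncard ∧
      D'.boundaryLength = D.cutLength A := by
  have hw : ∀ (d : D.SubDart A) (f : A), (DiscMap.subMap hA hconn hout).left d = some f →
      ((DiscMap.subMap hA hconn hout).boundaryCycle d).map (fun e => D.label e.1) = D.word d :=
    fun d f h => by
      have := DiscMap.subMap_boundaryCycle hA hconn hout d ⟨f, f.2, DiscMap.subLeft_eq_some.1 h⟩
      rw [word, ← this]
      exact (List.map_map (f := fun e : D.SubDart A => (e : D.Dart)) (g := D.label)).symm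
  let D' : VanKampenDiagram R :=
    { DiscMap.subMap hA hconn hout with
      label := fun d => D.label d.1
      label_rev := fun d => D.label_rev d.1
      face_relator := fun d f h => by
        obtain ⟨r, hr, h'⟩ := D.face_relator d.1 f.1 (DiscMap.subLeft_eq_some.1 h)
        refine ⟨r, hr, ?_⟩
        have := hw d f h
        rw [word] at this
        rw [← this] at h'
        exact h' }
  refine ⟨D', fun d f g h1 h2 => ?_, DiscMap.subMap_innerConnected hA hconn hout, rfl,
    DiscMap.subMap_boundaryLength hA hconn hout⟩
  have e1 : D'.word d = D.word d.1 := hw d f h1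
  have e2 : D'.word (D'.rev d) = D.word (D.rev d.1) := hw _ g h2
  rw [e1, e2]
  exact hD d.1 f.1 g.1 (DiscMap.subLeft_eq_some.1 h1) (DiscMap.subLeft_eq_some.1 h2)

end VanKampenDiagram

/-! ### Cut lengths, components and filling of holes. -/

namespace DiscMap

variable {D : DiscMap}

theorem InSet.mono {S T : Set D.Face} (h : S ⊆ T) {d : D.Dart} (hd : D.InSet S d) :
    D.InSet T d := by
  obtain ⟨f, hf, hl⟩ := hd
  exact ⟨f, h hf, hl⟩

theorem inSet_iff_of_left {S : Set D.Face} {d : D.Dart} {f : D.Face} (h : D.left d = some f) :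
    D.InSet S d ↔ f ∈ S := by
  simp [InSet, h]

theorem OuterReach.mem {T : Set D.Face} {f : D.Face} (h : D.OuterReach T f) : f ∈ T := by
  cases h <;> assumption

theorem OuterReach.mono {S T : Set D.Face} (hST : S ⊆ T) {f : D.Face} (h : D.OuterReach S f) :
    D.OuterReach T f := by
  induction h with
  | base d f hf h1 h2 => exact .base d f (hST hf) h1 h2
  | step d f g hf h1 h2 _ ih => exact .step d f g (hST hf) h1 h2 ih

theorem outerReach_univ (f : D.Face) : D.OuterReach Set.univ f := by
  have : ∀ w, Relation.ReflTransGen (DartAdj D.rev D.left) w none →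
      ∀ f, w = some f → D.OuterReach Set.univ f := fun w hw => by
    induction hw using Relation.ReflTransGen.head_induction_on with
    | refl => exact fun f h => absurd h (Option.some_ne_none f).symm
    | head hd _ ih =>
      rintro f rfl
      obtain ⟨d, h1, rfl⟩ := hd
      cases h2 : D.left (D.rev d) with
      | none => exact .base d f trivial h1 h2
      | some g => exact .step d f g trivial h1 h2 (ih g h2)
  exact this _ (D.dual_connected _ _) f rfl

/-- A part of a cosimple set which is separated from the rest of it is cosimple. -/
theorem Cosimple.of_separated {S T : Set D.Face} (hS : D.Cosimple S) (hTS : T ⊆ S)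
    (hsep : ∀ d, D.InSet T d → ¬ D.InSet (S \ T) (D.rev d)) : D.Cosimple T := by
  intro f hf
  induction outerReach_univ f with
  | base d f _ h1 h2 => exact .base d f hf h1 h2
  | step d f g _ h1 h2 _ ih =>
    by_cases hg : g ∈ T
    -- A face outside `T` but adjacent to `T` cannot lie in `S`, so it already escapes through the
    -- complement of `S`.
    · have hfS : f ∉ S := fun hfS => hsep (D.rev d) ⟨g, hg, h2⟩
        ⟨f, ⟨hfS, hf⟩, by rw [D.rev_rev, h1]⟩
      exact (hS f hfS).mono (Set.compl_subset_compl.2 hTS)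
    · exact .step d f g hf h1 h2 (ih hg)

/-- The darts crossing from `A` to its complement, with a face of `A` on the left. -/
def cutSet (A : Set D.Face) : Set D.Dart := {d | D.InSet A d ∧ ¬ D.InSet A (D.rev d)}

theorem cutLength_eq_ncard (A : Set D.Face) : D.cutLength A = (cutSet A).ncard := rfl

theorem cutLength_add_le {S T : Set D.Face} (hTS : T ⊆ S)
    (hsep : ∀ d, D.InSet T d → ¬ D.InSet (S \ T) (D.rev d)) :
    D.cutLength T + D.cutLength (S \ T) ≤ D.cutLength S := by
  rw [cutLength_eq_ncard, cutLength_eq_ncard, cutLength_eq_ncard, ← Set.ncard_union_eq]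
  · refine Set.ncard_le_ncard ?_ (Set.toFinite _)
    rintro d (⟨h1, h2⟩ | ⟨h1, h2⟩)
    · refine ⟨h1.mono hTS, fun ⟨f, hf, hl⟩ => ?_⟩
      by_cases hfT : f ∈ T
      · exact h2 ⟨f, hfT, hl⟩
      · exact hsep d h1 ⟨f, ⟨hf, hfT⟩, hl⟩
    · refine ⟨h1.mono Set.sdiff_subset, fun ⟨f, hf, hl⟩ => ?_⟩
      by_cases hfT : f ∈ T
      · exact hsep (D.rev d) ⟨f, hfT, hl⟩ (by rwa [D.rev_rev])
      · exact h2 ⟨f, ⟨hf, hfT⟩, hl⟩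
  · rw [Set.disjoint_left]
    rintro d ⟨⟨f, hf, hl⟩, _⟩ ⟨h, _⟩
    rw [inSet_iff_of_left hl] at h
    exact h.2 hf

/-- A linear isoperimetric inequality for discs extends to disjoint unions of discs. -/
theorem mul_ncard_le_cutLength (κ : ℝ) (S : Set D.Face) (hS : D.Cosimple S)
    (h : ∀ A ⊆ S, A.Nonempty → (∀ f ∈ A, ∀ g ∈ A, Relation.ReflTransGen (D.AdjIn A) f g) →
      D.Cosimple A → κ * A.ncard ≤ D.cutLength A) :
    κ * S.ncard ≤ D.cutLength S := by
  induction hn : S.ncard using Nat.strong_induction_on generalizing S with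
  | _ n ih =>
    subst hn
    rcases S.eq_empty_or_nonempty with rfl | ⟨f, hf⟩
    · simp
    -- Split off one connected component: both face counts and cut lengths are additive enough for
    -- induction.
    let A : Set D.Face := {g | Relation.ReflTransGen (D.AdjIn S) f g}
    have hAS : A ⊆ S := fun g hg => by
      rcases Relation.ReflTransGen.cases_tail hg with rfl | ⟨_, _, h⟩
      · exact hf
      · exact h.2.1
    have hfA : f ∈ A := Relation.ReflTransGen.refl
    have hsymm : Std.Symm (D.AdjIn A) := ⟨fun g k ⟨hg, hk, d, h1, h2⟩ =>
      ⟨hk, hg, D.rev d, h2, by rw [D.rev_rev, h1]⟩⟩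
    have hfrom : ∀ g, Relation.ReflTransGen (D.AdjIn S) f g →
        Relation.ReflTransGen (D.AdjIn A) f g := fun g hg => by
      induction hg with
      | refl => exact .refl
      | tail hg hk ih => exact ih.tail ⟨hg, hg.tail hk, hk.2.2⟩
    have hconn : ∀ g ∈ A, ∀ k ∈ A, Relation.ReflTransGen (D.AdjIn A) g k := fun g hg k hk =>
      (Relation.ReflTransGen.stdSymm.symm _ _ (hfrom g hg)).trans (hfrom k hk)
    have hsep : ∀ d, D.InSet A d → ¬ D.InSet (S \ A) (D.rev d) :=
      fun d ⟨g, hg, hgl⟩ ⟨k, hk, hkl⟩ =>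
        hk.2 (Relation.ReflTransGen.tail hg ⟨hAS hg, hk.1, d, hgl, hkl⟩)
    have hsep' : ∀ d, D.InSet (S \ A) d → ¬ D.InSet (S \ (S \ A)) (D.rev d) := fun d hd hd' =>
      hsep (D.rev d) (hd'.mono fun g hg => by_contra fun hgA => hg.2 ⟨hg.1, hgA⟩)
        (by rwa [D.rev_rev])
    have h1 := h A hAS ⟨f, hfA⟩ hconn (hS.of_separated hAS hsep)
    have hlt : (S \ A).ncard < S.ncard :=
      Set.ncard_lt_ncard ⟨Set.sdiff_subset, fun hsub => (hsub hf).2 hfA⟩ (Set.toFinite _)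
    have h2 := ih _ hlt (S \ A) (hS.of_separated Set.sdiff_subset hsep')
      (fun B hB => h B (hB.trans Set.sdiff_subset)) rfl
    have h3 : ((D.cutLength A : ℝ) + D.cutLength (S \ A)) ≤ D.cutLength S := by
      exact_mod_cast cutLength_add_le hAS hsep
    have h4 : ((S \ A).ncard : ℝ) + A.ncard = S.ncard := by
      exact_mod_cast Set.ncard_sdiff_add_ncard_of_subset hAS (Set.toFinite _)
    rw [← h4]
    linarith

/-- The union of a set of faces and of the components of its complement that are not adjacent to
the outer region. -/
def fill (S : Set D.Face) : Set D.Face := {f | ¬ D.OuterReach Sᶜ f}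

theorem subset_fill (S : Set D.Face) : S ⊆ fill S := fun _ hf h => h.mem hf

theorem cosimple_fill (S : Set D.Face) : D.Cosimple (fill S) := by
  intro f hf
  induction not_not.1 hf with
  | base d f hfS h1 h2 => exact .base d f hf h1 h2
  | step d f g hfS h1 h2 hg ih => exact .step d f g hf h1 h2 (ih fun h => h hg)

/-- A face outside `S` that borders the exterior of the filling would itself reach the outer region.
Hence filling creates no new cut edges. -/
theorem mem_of_mem_fill {S : Set D.Face} {d : D.Dart} (h1 : D.InSet (fill S) d)
    (h2 : ¬ D.InSet (fill S) (D.rev d)) : D.InSet S d := by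
  obtain ⟨f, hf, hl⟩ := h1
  refine ⟨f, by_contra fun hfS => hf ?_, hl⟩
  cases hr : D.left (D.rev d) with
  | none => exact .base d f hfS hl hr
  | some g =>
    rw [inSet_iff_of_left hr] at h2
    exact .step d f g hfS hl hr (not_not.1 h2)

theorem cutLength_fill_le (S : Set D.Face) : D.cutLength (fill S) ≤ D.cutLength S :=
  Set.ncard_le_ncard (fun _ hd => ⟨mem_of_mem_fill hd.1 hd.2,
    fun h => hd.2 (h.mono (subset_fill S))⟩) (Set.toFinite _)

/-- A linear isoperimetric inequality for discs extends to arbitrary sets of faces. -/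
theorem mul_ncard_le_cutLength_of_discs {κ : ℝ} (hκ : 0 ≤ κ)
    (h : ∀ A : Set D.Face, A.Nonempty →
      (∀ f ∈ A, ∀ g ∈ A, Relation.ReflTransGen (D.AdjIn A) f g) →
      D.Cosimple A → κ * A.ncard ≤ D.cutLength A) (S : Set D.Face) :
    κ * S.ncard ≤ D.cutLength S := by
  -- Filling adds faces and does not lengthen the cut, so the inequality for the filling is the
  -- stronger one when κ ≥ 0.
  have h1 := mul_ncard_le_cutLength κ (fill S) (cosimple_fill S) fun A _ => h A
  have h2 : (S.ncard : ℝ) ≤ (fill S).ncard := by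
    exact_mod_cast Set.ncard_le_ncard (subset_fill S) (Set.toFinite _)
  have h3 : (D.cutLength (fill S) : ℝ) ≤ D.cutLength S := by
    exact_mod_cast cutLength_fill_le S
  exact (mul_le_mul_of_nonneg_left h2 hκ).trans (h1.trans h3)

/-- The darts crossing from `A` to the faces outside `A`. -/
def innerCutSet (A : Set D.Face) : Set D.Dart := {d | D.InSet A d ∧ D.InSet Aᶜ (D.rev d)}

theorem ncard_le_of_rev {S T : Set D.Dart} (h : ∀ d ∈ S, D.rev d ∈ T) : S.ncard ≤ T.ncard :=
  Set.ncard_le_ncard_of_injOn D.rev h D.rev.injective.injOn (Set.toFinite _)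

theorem ncard_innerCutSet_compl_le (A : Set D.Face) :
    (innerCutSet Aᶜ).ncard ≤ (innerCutSet A).ncard :=
  ncard_le_of_rev fun d hd => ⟨by simpa using hd.2, by rw [D.rev_rev]; exact hd.1⟩

theorem ncard_innerCutSet_fill_le (S : Set D.Face) :
    (innerCutSet (fill S)).ncard ≤ (innerCutSet S).ncard := by
  refine Set.ncard_le_ncard (fun d hd => ?_) (Set.toFinite _)
  obtain ⟨h1, f, hf, hl⟩ := hd
  exact ⟨mem_of_mem_fill h1 (by rw [inSet_iff_of_left hl]; exact hf),
    f, fun h => hf (subset_fill S h), hl⟩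

/-- A hole touches neither the outer region nor the rest of the complement of `S`, so all of its
boundary edges face `S`. -/
theorem cutLength_holes_le (S : Set D.Face) :
    D.cutLength (fill S \ S) ≤ (innerCutSet S).ncard := by
  refine ncard_le_of_rev fun d hd => ?_
  obtain ⟨⟨f, hf, hl⟩, h2⟩ := hd
  have h3 : D.InSet (fill S) (D.rev d) := by
    by_contra h
    have := mem_of_mem_fill ⟨f, hf.1, hl⟩ h
    rw [inSet_iff_of_left hl] at this
    exact hf.2 this
  obtain ⟨g, hg, hgl⟩ := h3
  rw [inSet_iff_of_left hgl] at h2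
  exact ⟨⟨g, by_contra fun h => h2 ⟨hg, h⟩, hgl⟩, f, hf.2, by rw [D.rev_rev, hl]⟩

/-- An edge between `A` and its complement is counted from both sides; every other counted edge lies
on the outer boundary. -/
theorem cutLength_add_cutLength_compl_le (A : Set D.Face) :
    D.cutLength A + D.cutLength Aᶜ ≤ D.boundaryLength + 2 * (innerCutSet A).ncard := by
  have h1 : cutSet A ∪ cutSet Aᶜ ⊆
      (innerCutSet A ∪ innerCutSet Aᶜ) ∪ D.rev ⁻¹' {d | D.left d = none} := by
    have key : ∀ (B : Set D.Face) (d : D.Dart), d ∈ cutSet B →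
        d ∈ innerCutSet B ∨ D.left (D.rev d) = none := fun B d hd => by
      cases hr : D.left (D.rev d) with
      | none => exact Or.inr rfl
      | some g =>
        have := hd.2
        rw [inSet_iff_of_left hr] at this
        exact Or.inl ⟨hd.1, g, this, hr⟩
    rintro d (hd | hd)
    · exact (key A d hd).elim (fun h => Or.inl (Or.inl h)) Or.inr
    · exact (key Aᶜ d hd).elim (fun h => Or.inl (Or.inr h)) Or.inr
  have h2 : Disjoint (cutSet A) (cutSet Aᶜ) := by
    rw [Set.disjoint_left]
    rintro d ⟨⟨f, hf, hl⟩, _⟩ ⟨h, _⟩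
    rw [inSet_iff_of_left hl] at h
    exact h hf
  have h3 : (D.rev ⁻¹' {d | D.left d = none}).ncard ≤ D.boundaryLength :=
    ncard_le_of_rev (T := {d | D.left d = none}) fun d hd => hd
  rw [cutLength_eq_ncard, cutLength_eq_ncard, ← Set.ncard_union_eq h2]
  have h4 := Set.ncard_le_ncard h1 (Set.toFinite _)
  have h5 := Set.ncard_union_le (innerCutSet A ∪ innerCutSet Aᶜ)
    (D.rev ⁻¹' {d | D.left d = none})
  have h6 := Set.ncard_union_le (innerCutSet A) (innerCutSet Aᶜ)
  have h7 := ncard_innerCutSet_compl_le A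
  omega

theorem cutLength_univ_le : D.cutLength Set.univ ≤ D.boundaryLength := by
  refine ncard_le_of_rev (T := {d | D.left d = none}) fun d hd => ?_
  cases hr : D.left (D.rev d) with
  | none => exact hr
  | some g => exact (hd.2 ⟨g, trivial, hr⟩).elim

/-- A short cut can be modified so that both sides are disjoint unions of discs; the isoperimetric
inequality bounds the loss. -/
theorem exists_cosimple_cut {κ m : ℝ} (hiso : ∀ S : Set D.Face, κ * S.ncard ≤ D.cutLength S)
    (hκ : 0 ≤ κ) (S : Set D.Face) (hS : (innerCutSet S).ncard ≤ m) :
    ∃ A : Set D.Face, D.Cosimple A ∧ D.Cosimple Aᶜ ∧ (innerCutSet A).ncard ≤ m ∧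
      κ * S.ncard ≤ κ * A.ncard + m ∧ κ * Sᶜ.ncard ≤ κ * Aᶜ.ncard + m := by
  have hbound : ∀ T : Set D.Face, (innerCutSet T).ncard ≤ m →
      κ * (fill T \ T).ncard ≤ m := fun T hT => by
    have : (D.cutLength (fill T \ T) : ℝ) ≤ (innerCutSet T).ncard := by
      exact_mod_cast cutLength_holes_le T
    exact (hiso _).trans (this.trans hT)
  have h1 : ((innerCutSet (fill S)).ncard : ℝ) ≤ m :=
    le_trans (by exact_mod_cast ncard_innerCutSet_fill_le S) hS
  have h2 : ((innerCutSet (fill S)ᶜ).ncard : ℝ) ≤ m :=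
    le_trans (by exact_mod_cast ncard_innerCutSet_compl_le _) h1
  have h3 : ((innerCutSet (fill (fill S)ᶜ)).ncard : ℝ) ≤ m :=
    le_trans (by exact_mod_cast ncard_innerCutSet_fill_le _) h2
  have hsub : (fill (fill S)ᶜ)ᶜ ⊆ fill S := by
    rw [Set.compl_subset_comm]
    exact subset_fill _
  -- Fill the holes of `S`, then those of the new complement. Neither filling lengthens the inner
  -- cut, and by the isoperimetric inequality each moves at most `m / κ` faces (for κ > 0) to the
  -- other side.
  refine ⟨(fill (fill S)ᶜ)ᶜ, ?_, by rw [compl_compl]; exact cosimple_fill _,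
    le_trans (by exact_mod_cast ncard_innerCutSet_compl_le _) h3, ?_, ?_⟩
  · intro f hf
    rw [compl_compl]
    rw [Set.mem_compl_iff, not_not] at hf
    induction outerReach_univ f with
    | base d f _ ha hb => exact .base d f hf ha hb
    | step d f g _ ha hb _ ih =>
      by_cases hg : g ∈ fill (fill S)ᶜ
      · exact .step d f g hf ha hb (ih hg)
      -- The second filling does not spoil the first: a hole of the complement adjacent to a face
      -- that escapes through `fill S` would escape too.
      · by_cases hfS : f ∈ fill S
        · have hg' : D.OuterReach (fill S)ᶜᶜ g := not_not.1 hg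
          exact (hf (.step d f g (by rwa [compl_compl]) ha hb hg')).elim
        · exact (cosimple_fill S f hfS).mono (subset_fill _)
  · have hb := hbound _ h2
    have hle : (S.ncard : ℝ) ≤ (fill (fill S)ᶜ)ᶜ.ncard + (fill (fill S)ᶜ \ (fill S)ᶜ).ncard := by
      have h5 : S ⊆ (fill (fill S)ᶜ)ᶜ ∪ (fill (fill S)ᶜ \ (fill S)ᶜ) := fun f hf => by
        by_cases hf' : f ∈ fill (fill S)ᶜ
        · exact Or.inr ⟨hf', not_not.2 (subset_fill S hf)⟩
        · exact Or.inl hf'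
      exact_mod_cast (Set.ncard_le_ncard h5 (Set.toFinite _)).trans (Set.ncard_union_le _ _)
    have := mul_le_mul_of_nonneg_left hle hκ
    linarith
  · have hb := hbound _ hS
    have hle : (Sᶜ.ncard : ℝ) ≤ (fill (fill S)ᶜ)ᶜᶜ.ncard + (fill S \ S).ncard := by
      have h5 : Sᶜ ⊆ (fill (fill S)ᶜ)ᶜᶜ ∪ (fill S \ S) := fun f hf => by
        by_cases hf' : f ∈ fill S
        · exact Or.inr ⟨hf', hf⟩
        · rw [compl_compl]
          exact Or.inl (subset_fill _ hf')
      exact_mod_cast (Set.ncard_le_ncard h5 (Set.toFinite _)).trans (Set.ncard_union_le _ _)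
    have := mul_le_mul_of_nonneg_left hle hκ
    linarith

end DiscMap

/-! ### Layers around the outer region and logarithmic depth. -/

namespace DiscMap

variable {D : DiscMap}

theorem ncard_inSet_le {ℓ : ℕ} (hℓ : ∀ f : D.Face, D.regionLength (some f) = ℓ)
    (T : Set D.Face) : {d | D.InSet T d}.ncard ≤ ℓ * T.ncard := by
  classical
  rw [Set.ncard_eq_toFinset_card', Set.ncard_eq_toFinset_card',
    ← Finset.card_image_of_injective T.toFinset (Option.some_injective D.Face)]
  refine Finset.card_le_mul_card_image_of_maps_to (f := D.left) (fun d hd => ?_) _ fun w hw => ?_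
  · simp only [Set.mem_toFinset, Set.mem_ofPred_eq] at hd
    obtain ⟨f, hf, hl⟩ := hd
    rw [hl]
    exact Finset.mem_image_of_mem _ (Set.mem_toFinset.2 hf)
  · obtain ⟨f, _, rfl⟩ := Finset.mem_image.1 hw
    rw [← hℓ f, regionLength, Nat.card_eq_fintype_card, Fintype.card_subtype]
    exact Finset.card_le_card fun d hd => by
      simp only [Finset.mem_filter] at hd
      simp [hd.2]

/-- The faces at dual distance at most `k` from the outer region. -/
def nearBoundary (D : DiscMap) : ℕ → Set D.Face
  | 0 => ∅
  | k + 1 => {f | ∃ d, D.left d = some f ∧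
      (D.left (D.rev d) = none ∨ D.InSet (D.nearBoundary k) (D.rev d))}

theorem nearBoundary_subset_succ (k : ℕ) : D.nearBoundary k ⊆ D.nearBoundary (k + 1) := by
  induction k with
  | zero => exact Set.empty_subset _
  | succ k ih =>
    rintro f ⟨d, hd, h⟩
    exact ⟨d, hd, h.imp id fun h => h.mono ih⟩

/-- Every boundary edge of the deeper part faces the layer just outside it, which has ℓ edge sides
per face. So the layer has at least `C` times as many faces as the deeper part. -/
theorem ncard_compl_nearBoundary_succ {ℓ : ℕ} {C : ℝ} (hℓ0 : 0 < ℓ)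
    (hℓ : ∀ f : D.Face, D.regionLength (some f) = ℓ)
    (hiso : ∀ S : Set D.Face, C * ℓ * S.ncard ≤ D.cutLength S) (k : ℕ) :
    (1 + C) * (D.nearBoundary (k + 1))ᶜ.ncard ≤ (D.nearBoundary k)ᶜ.ncard := by
  have h1 : D.cutLength (D.nearBoundary (k + 1))ᶜ ≤
      ℓ * (D.nearBoundary (k + 1) \ D.nearBoundary k).ncard := by
    refine le_trans (ncard_le_of_rev fun d hd => ?_) (ncard_inSet_le hℓ _)
    obtain ⟨⟨f, hf, hl⟩, h2⟩ := hd
    cases hr : D.left (D.rev d) with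
    | none => exact (hf ⟨d, hl, Or.inl hr⟩).elim
    | some g =>
      rw [inSet_iff_of_left hr, Set.mem_compl_iff, not_not] at h2
      exact ⟨g, ⟨h2, fun hg => hf ⟨d, hl, Or.inr ⟨g, hg, hr⟩⟩⟩, hr⟩
  have h2 : (D.nearBoundary (k + 1) \ D.nearBoundary k).ncard + (D.nearBoundary (k + 1))ᶜ.ncard =
      (D.nearBoundary k)ᶜ.ncard := by
    have hdis : Disjoint (D.nearBoundary (k + 1) \ D.nearBoundary k) (D.nearBoundary (k + 1))ᶜ :=
      Set.disjoint_left.2 fun f hf hf' => hf' hf.1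
    rw [← Set.ncard_union_eq hdis]
    congr 1
    ext f
    simp only [Set.mem_union, Set.mem_sdiff, Set.mem_compl_iff]
    constructor
    · rintro (h | h)
      · exact h.2
      · exact fun h' => h (nearBoundary_subset_succ k h')
    · intro h
      by_cases h' : f ∈ D.nearBoundary (k + 1)
      · exact Or.inl ⟨h', h⟩
      · exact Or.inr h'
  have h3 := hiso (D.nearBoundary (k + 1))ᶜ
  have h4 : (D.cutLength (D.nearBoundary (k + 1))ᶜ : ℝ) ≤
      ℓ * (D.nearBoundary (k + 1) \ D.nearBoundary k).ncard := by exact_mod_cast h1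
  have h5 : ((D.nearBoundary (k + 1) \ D.nearBoundary k).ncard : ℝ) +
      (D.nearBoundary (k + 1))ᶜ.ncard = (D.nearBoundary k)ᶜ.ncard := by exact_mod_cast h2
  have hpos : (0 : ℝ) < ℓ := by exact_mod_cast hℓ0
  have h6 : C * (D.nearBoundary (k + 1))ᶜ.ncard ≤
      (D.nearBoundary (k + 1) \ D.nearBoundary k).ncard := by
    refine le_of_mul_le_mul_left ?_ hpos
    linarith
  linarith

/-- The depth of a diagram is at most logarithmic. -/
theorem nearBoundary_eq_univ {ℓ : ℕ} {C : ℝ} (hC : 0 < C) (hℓ0 : 0 < ℓ)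
    (hℓ : ∀ f : D.Face, D.regionLength (some f) = ℓ)
    (hiso : ∀ S : Set D.Face, C * ℓ * S.ncard ≤ D.cutLength S) (h : ℕ)
    (hh : (D.numFaces : ℝ) < (1 + C) ^ h) : D.nearBoundary h = Set.univ := by
  have key : ∀ k : ℕ, (1 + C) ^ k * (D.nearBoundary k)ᶜ.ncard ≤ D.numFaces := fun k => by
    induction k with
    | zero =>
      rw [pow_zero, one_mul, nearBoundary, Set.compl_empty, Set.ncard_univ]
      exact le_rfl
    | succ k ih =>
      refine le_trans ?_ ih
      rw [pow_succ, mul_assoc]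
      exact mul_le_mul_of_nonneg_left (ncard_compl_nearBoundary_succ hℓ0 hℓ hiso k) (by positivity)
  by_contra hne
  have h1 : 1 ≤ (D.nearBoundary h)ᶜ.ncard := by
    rw [Nat.one_le_iff_ne_zero, Ne, Set.ncard_eq_zero (Set.toFinite _), Set.compl_empty_iff]
    exact hne
  have h2 : (1 : ℝ) ≤ (D.nearBoundary h)ᶜ.ncard := by exact_mod_cast h1
  have h3 := key h
  have h4 : (1 + C) ^ h * 1 ≤ (1 + C) ^ h * (D.nearBoundary h)ᶜ.ncard :=
    mul_le_mul_of_nonneg_left h2 (by positivity)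
  linarith

/-! ### Relative cycles, their primitives, and balanced cuts. -/

/-- The number of darts on which a chain does not vanish. -/
noncomputable def chainSize (x : D.Dart → ZMod 2) : ℕ := (Function.support x).ncard

theorem chainSize_add_le (x y : D.Dart → ZMod 2) :
    chainSize (x + y) ≤ chainSize x + chainSize y :=
  (Set.ncard_le_ncard (Function.support_add x y) (Set.toFinite _)).trans (Set.ncard_union_le _ _)

theorem chainSize_zero : chainSize (0 : D.Dart → ZMod 2) = 0 := by
  unfold chainSize
  rw [Function.support_zero, Set.ncard_empty]

theorem edgeChain_eq_zero {d e : D.Dart} (h1 : e ≠ d) (h2 : e ≠ D.rev d) :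
    edgeChain D.rev d e = 0 := by
  simp [edgeChain, h1, h2]

theorem chainSize_edgeChain_le (d : D.Dart) : chainSize (edgeChain D.rev d) ≤ 2 := by
  have h : Function.support (edgeChain D.rev d) ⊆ {d, D.rev d} := fun e he => by
    by_contra hne
    simp only [Set.mem_insert_iff, Set.mem_singleton_iff, not_or] at hne
    exact he (edgeChain_eq_zero hne.1 hne.2)
  refine (Set.ncard_le_ncard h (Set.toFinite _)).trans ((Set.ncard_insert_le _ _).trans ?_)
  rw [Set.ncard_singleton]

/-- The chain of `n` successive edges of a boundary cycle, starting with the edge of `d`. -/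
noncomputable def arcChain (d : D.Dart) (n : ℕ) : D.Dart → ZMod 2 :=
  ∑ j ∈ Finset.range n, edgeChain D.rev (D.next^[j] d)

theorem arcChain_succ (d : D.Dart) (n : ℕ) :
    arcChain d (n + 1) = arcChain d n + edgeChain D.rev (D.next^[n] d) :=
  Finset.sum_range_succ _ _

theorem arcChain_zero (d : D.Dart) : arcChain d 0 = 0 := rfl

theorem arcChain_one (d : D.Dart) : arcChain d 1 = edgeChain D.rev d := by
  rw [arcChain_succ, arcChain_zero, zero_add]
  rfl

theorem arcChain_mem (d : D.Dart) (n : ℕ) : arcChain d n ∈ symChains D.rev :=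
  Submodule.sum_mem _ fun _ _ => edgeChain_mem D.rev D.rev_rev _

theorem chainSize_arcChain_le (d : D.Dart) (n : ℕ) : chainSize (arcChain d n) ≤ 2 * n := by
  induction n with
  | zero => rw [arcChain_zero, chainSize_zero]
  | succ n ih =>
    rw [arcChain_succ]
    refine (chainSize_add_le _ _).trans ?_
    have := chainSize_edgeChain_le (D.next^[n] d)
    omega

theorem add_add_add_cancel_mid {V : Type*} (a b c : V → ZMod 2) :
    (a + b) + (b + c) = a + c := by
  rw [add_assoc, ← add_assoc b, ZMod2.fun_add_self, zero_add]

theorem bdry_arcChain [DecidableEq D.Vertex] (d : D.Dart) (n : ℕ) :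
    bdry D.src (arcChain d n) =
      Pi.single (D.src d) 1 + Pi.single (D.src (D.next^[n] d)) 1 := by
  induction n with
  | zero => rw [arcChain_zero, map_zero, Function.iterate_zero, id, ZMod2.fun_add_self]
  | succ n ih =>
    rw [arcChain_succ, map_add, ih, bdry_edgeChain, add_add_add_cancel_mid,
      Function.iterate_succ_apply', src_next]

/-- The vertices on the boundary of the outer region. -/
def IsBoundary (v : D.Vertex) : Prop := ∃ e, D.left e = none ∧ D.src e = v

/-- Chains whose boundary consists of two boundary vertices. -/
def IsRelCycle (x : D.Dart → ZMod 2) : Prop :=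
  open Classical in x ∈ symChains D.rev ∧ ∃ v w, IsBoundary v ∧ IsBoundary w ∧
    bdry D.src x = Pi.single v 1 + Pi.single w 1

/-- The function `c` of the faces jumps precisely across the interior edges of the chain `x`. -/
def IsPrimitive (c : D.Face → ZMod 2) (x : D.Dart → ZMod 2) : Prop :=
  ∀ d f g, D.left d = some f → D.left (D.rev d) = some g → x d = c f + c g

theorem IsPrimitive.add {c c' : D.Face → ZMod 2} {x x' : D.Dart → ZMod 2}
    (h : IsPrimitive c x) (h' : IsPrimitive c' x') : IsPrimitive (c + c') (x + x') :=
  fun d f g h1 h2 => by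
    rw [Pi.add_apply, Pi.add_apply, Pi.add_apply, h d f g h1 h2, h' d f g h1 h2]
    ring

/-- An arc of the outer boundary closes the chain to a cycle, which bounds; the arc contains no
interior edge, so jumps across these are unaffected. -/
theorem IsRelCycle.exists_isPrimitive {x : D.Dart → ZMod 2} (hx : IsRelCycle x) :
    ∃ c, IsPrimitive c x := by
  classical
  obtain ⟨hs, v, w, ⟨e, he, rfl⟩, ⟨e', he', rfl⟩, hb⟩ := hx
  obtain ⟨n, hn⟩ := ((D.left_eq_iff e e').1 (he.trans he'.symm)).exists_nat_pow_eq
  rw [← Equiv.Perm.iterate_eq_pow] at hn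
  obtain ⟨c, hc⟩ := D.exists_coboundary (Submodule.add_mem _ hs (arcChain_mem e n)) (by
    rw [map_add, bdry_arcChain, hn, hb]
    exact ZMod2.fun_add_self _)
  refine ⟨fun f => c (some f), fun d f g h1 h2 => ?_⟩
  have h3 : arcChain e n d = 0 := by
    rw [arcChain, Finset.sum_apply]
    refine Finset.sum_eq_zero fun j _ => edgeChain_eq_zero (fun h => ?_) fun h => ?_
    · rw [h, left_next_iterate, he] at h1
      exact Option.some_ne_none _ h1.symm
    · rw [h, D.rev_rev, left_next_iterate, he] at h2
      exact Option.some_ne_none _ h2.symm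
  have := hc d
  rwa [Pi.add_apply, h3, add_zero, h1, h2] at this

/-- The factor 2 appears because `chainSize` counts both darts of an edge, while `innerCutSet`
counts one. -/
theorem IsPrimitive.two_mul_ncard_le {c : D.Face → ZMod 2} {x : D.Dart → ZMod 2}
    (h : IsPrimitive c x) :
    2 * (innerCutSet (Function.support c)).ncard ≤ chainSize x := by
  have h1 : innerCutSet (Function.support c) ∪ innerCutSet (Function.support c)ᶜ ⊆
      Function.support x := by
    rintro d (⟨⟨f, hf, h1⟩, g, hg, h2⟩ | ⟨⟨f, hf, h1⟩, g, hg, h2⟩)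
    · rw [Function.mem_support, h d f g h1 h2, Function.notMem_support.1 hg, add_zero]
      exact hf
    · rw [Function.mem_support, h d f g h1 h2, Function.notMem_support.1 hf, zero_add]
      rw [compl_compl] at hg
      exact hg
  have h2 : Disjoint (innerCutSet (Function.support c)) (innerCutSet (Function.support c)ᶜ) := by
    rw [Set.disjoint_left]
    rintro d ⟨⟨f, hf, hl⟩, _⟩ ⟨h, _⟩
    rw [inSet_iff_of_left hl] at h
    exact h hf
  have h3 := Set.ncard_le_ncard h1 (Set.toFinite _)
  rw [Set.ncard_union_eq h2] at h3
  have h4 := ncard_innerCutSet_compl_le (Function.support c)ᶜ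
  rw [compl_compl] at h4
  unfold chainSize
  omega

open Classical in
theorem isCycleOn_next (w : Option D.Face) :
    D.next.IsCycleOn ↑(Finset.univ.filter fun e => D.left e = w) := by
  refine ⟨⟨fun e he => ?_, D.next.injective.injOn, fun e he => ⟨D.next.symm e, ?_, ?_⟩⟩,
    fun e he e' he' => ?_⟩
  · simp only [Finset.coe_filter, Finset.mem_univ, true_and, Set.mem_ofPred_eq] at he ⊢
    rw [left_next, he]
  · simp only [Finset.coe_filter, Finset.mem_univ, true_and, Set.mem_ofPred_eq] at he ⊢
    rw [← left_next, Equiv.apply_symm_apply, he]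
  · exact Equiv.apply_symm_apply _ _
  · simp only [Finset.coe_filter, Finset.mem_univ, true_and, Set.mem_ofPred_eq] at he he'
    exact (D.left_eq_iff _ _).1 (he.trans he'.symm)

open Classical in
theorem card_filter_left (w : Option D.Face) :
    (Finset.univ.filter fun e => D.left e = w).card = D.regionLength w := by
  rw [regionLength, Nat.card_eq_fintype_card, Fintype.card_subtype]

theorem next_iterate_regionLength {ℓ : ℕ} (hℓ : ∀ f : D.Face, D.regionLength (some f) = ℓ)
    {d : D.Dart} {f : D.Face} (hd : D.left d = some f) : D.next^[ℓ] d = d := by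
  classical
  have := (isCycleOn_next (some f)).pow_card_apply (a := d) (by simp [hd])
  rwa [card_filter_left, hℓ, ← Equiv.Perm.iterate_eq_pow] at this

theorem exists_next_iterate_eq {ℓ : ℕ} (hℓ : ∀ f : D.Face, D.regionLength (some f) = ℓ)
    {d e : D.Dart} {f : D.Face} (hd : D.left d = some f) (he : D.left e = some f) :
    ∃ n ≤ ℓ, D.next^[n] d = e := by
  classical
  obtain ⟨n, hn, h⟩ := (isCycleOn_next (some f)).exists_pow_eq (a := d) (b := e) (by simp [hd])
    (by simp [he])
  rw [card_filter_left, hℓ] at hn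
  exact ⟨n, hn.le, by rw [Equiv.Perm.iterate_eq_pow, h]⟩

open Classical in
theorem sum_next_iterate {M : Type*} [AddCommMonoid M] {ℓ : ℕ}
    (hℓ : ∀ f : D.Face, D.regionLength (some f) = ℓ) {d : D.Dart} {f : D.Face}
    (hd : D.left d = some f) (F : D.Dart → M) :
    ∑ j ∈ Finset.range ℓ, F (D.next^[j] d) =
      ∑ e ∈ Finset.univ.filter (fun e => D.left e = some f), F e := by
  refine Finset.sum_nbij (fun j => D.next^[j] d) (fun j _ => ?_) (fun i hi j hj h => ?_)
    (fun e he => ?_) fun _ _ => rfl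
  · simp [left_next_iterate, hd]
  · simp only [Finset.coe_range, Set.mem_Iio] at hi hj
    simp only [Equiv.Perm.iterate_eq_pow] at h
    rw [(isCycleOn_next (some f)).pow_apply_eq_pow_apply (by simp [hd]), card_filter_left, hℓ] at h
    exact h.eq_of_lt_of_lt hi hj
  · obtain ⟨n, hn, h⟩ := (isCycleOn_next (some f)).exists_pow_eq (a := d) (b := e) (by simp [hd])
      (by simpa using he)
    rw [card_filter_left, hℓ] at hn
    exact ⟨n, by simpa using hn, by simp only [Equiv.Perm.iterate_eq_pow, h]⟩

/-- Each layer costs at most ℓ edges: follow the boundary of the face to an edge leading to the next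
layer outward. -/
theorem exists_chain_to_boundary [DecidableEq D.Vertex] {ℓ : ℕ}
    (hℓ : ∀ f : D.Face, D.regionLength (some f) = ℓ) (k : ℕ) :
    ∀ f ∈ D.nearBoundary k, ∀ d, D.left d = some f → ∃ x ∈ symChains D.rev, ∃ w, IsBoundary w ∧
      bdry D.src x = Pi.single (D.src d) 1 + Pi.single w 1 ∧ chainSize x ≤ 2 * (ℓ * k) := by
  induction k with
  | zero => exact fun f hf => hf.elim
  | succ k ih =>
    rintro f ⟨e, he, hr⟩ d hd
    obtain ⟨n, hn, rfl⟩ := exists_next_iterate_eq hℓ hd he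
    have harc := chainSize_arcChain_le d n
    have hsrc : D.src (D.next (D.rev (D.next^[n] d))) = D.src (D.next^[n] d) := D.src_next_rev _
    rcases hr with hr | ⟨g, hg, hr⟩
    · refine ⟨arcChain d n, arcChain_mem d n, D.src (D.next^[n] d),
        ⟨_, by rw [left_next, hr], hsrc⟩, bdry_arcChain d n, ?_⟩
      nlinarith
    · obtain ⟨x, hx, w, hw, hb, hs⟩ := ih g hg (D.next (D.rev (D.next^[n] d)))
        (by rw [left_next, hr])
      refine ⟨arcChain d n + x, Submodule.add_mem _ (arcChain_mem d n) hx, w, hw, ?_, ?_⟩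
      · rw [map_add, bdry_arcChain, hb, hsrc, add_add_add_cancel_mid]
      · have := chainSize_add_le (arcChain d n) x
        nlinarith

theorem isPrimitive_face {ℓ : ℕ} (hℓ : ∀ f : D.Face, D.regionLength (some f) = ℓ)
    [DecidableEq D.Face] {d : D.Dart} {f : D.Face} (hd : D.left d = some f) :
    IsPrimitive (Pi.single f 1) (arcChain d ℓ) := by
  classical
  intro e g k h1 h2
  rw [arcChain, sum_next_iterate hℓ hd (edgeChain D.rev), Finset.sum_apply]
  simp only [edgeChain, Pi.add_apply, Finset.sum_add_distrib, Pi.single_apply]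
  have h3 : ∀ a : D.Dart, e = D.rev a ↔ D.rev e = a := fun a =>
    ⟨fun h => by rw [h, D.rev_rev], fun h => by rw [← h, D.rev_rev]⟩
  simp only [h3, Finset.sum_ite_eq, Finset.mem_filter, Finset.mem_univ, true_and, h1, h2,
    Option.some_inj]

theorem InnerConnected.isPrimitive_zero (hD : D.InnerConnected) {c : D.Face → ZMod 2}
    (hc : IsPrimitive c 0) {f : D.Face} (hf : c f = 0) : c = 0 := by
  ext g
  induction hD f g with
  | refl => exact hf
  | tail _ hd ih =>
    obtain ⟨d, h1, h2⟩ := hd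
    have := hc d _ _ h1 h2
    rw [ih, Pi.zero_apply, Pi.zero_apply, zero_add] at this
    exact this.symm

/-- The function `c` vanishes on more than two thirds of the faces. -/
def IsSmall (c : D.Face → ZMod 2) : Prop := 3 * (Function.support c).ncard < D.numFaces

/-- The sum of the three functions is a primitive of 0, hence constant. Three supports of less than
a third each miss a common face, so the constant is 0. -/
theorem isPrimitive_eq_add (hD : D.InnerConnected) {c₁ c₂ c₃ : D.Face → ZMod 2}
    {x₁ x₂ : D.Dart → ZMod 2} (h₁ : IsPrimitive c₁ x₁) (h₂ : IsPrimitive c₂ x₂)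
    (h₃ : IsPrimitive c₃ (x₁ + x₂)) (s₁ : IsSmall c₁) (s₂ : IsSmall c₂) (s₃ : IsSmall c₃) :
    c₃ = c₁ + c₂ := by
  have hp : IsPrimitive (c₁ + c₂ + c₃) 0 := by
    have := (h₁.add h₂).add h₃
    rwa [ZMod2.fun_add_self] at this
  obtain ⟨f, hf⟩ : ∃ f, f ∉ Function.support c₁ ∪ Function.support c₂ ∪ Function.support c₃ := by
    by_contra! h
    have h1 := Set.ncard_univ D.Face
    rw [← Set.eq_univ_of_forall h] at h1
    have h2 := Set.ncard_union_le (Function.support c₁ ∪ Function.support c₂) (Function.support c₃)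
    have h3 := Set.ncard_union_le (Function.support c₁) (Function.support c₂)
    unfold IsSmall numFaces at s₁ s₂ s₃
    omega
  simp only [Set.mem_union, not_or, Function.notMem_support] at hf
  have h0 := hD.isPrimitive_zero hp (f := f) (by simp [hf])
  calc c₃ = (c₁ + c₂) + (c₁ + c₂ + c₃) := by
        rw [← add_assoc, ZMod2.fun_add_self, zero_add]
    _ = c₁ + c₂ := by rw [h0, add_zero]

open Classical in
/-- The small primitive of a chain, if there is one. -/
noncomputable def smallPrimitive (x : D.Dart → ZMod 2) : D.Face → ZMod 2 :=
  if h : ∃ c, IsPrimitive c x ∧ IsSmall c then h.choose else 0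

theorem smallPrimitive_spec {x : D.Dart → ZMod 2} (h : ∃ c, IsPrimitive c x ∧ IsSmall c) :
    IsPrimitive (smallPrimitive x) x ∧ IsSmall (smallPrimitive x) := by
  rw [smallPrimitive, dif_pos h]
  exact h.choose_spec

theorem isSmall_zero (hN : 0 < D.numFaces) : IsSmall (0 : D.Face → ZMod 2) := by
  rw [IsSmall, Function.support_zero, Set.ncard_empty]
  exact hN

theorem isPrimitive_zero_zero : IsPrimitive (0 : D.Face → ZMod 2) 0 := fun _ _ _ _ _ => by
  rw [Pi.zero_apply, Pi.zero_apply, Pi.zero_apply, add_zero]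

theorem smallPrimitive_eq (hD : D.InnerConnected) (hN : 0 < D.numFaces)
    {x : D.Dart → ZMod 2} {c : D.Face → ZMod 2} (hc : IsPrimitive c x) (hs : IsSmall c) :
    smallPrimitive x = c := by
  have h := smallPrimitive_spec ⟨c, hc, hs⟩
  have := isPrimitive_eq_add hD hc isPrimitive_zero_zero (by rw [add_zero]; exact h.1) hs
    (isSmall_zero hN) h.2
  rwa [add_zero] at this

theorem smallPrimitive_add (hD : D.InnerConnected) {x y : D.Dart → ZMod 2}
    (hx : ∃ c, IsPrimitive c x ∧ IsSmall c) (hy : ∃ c, IsPrimitive c y ∧ IsSmall c)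
    (hxy : ∃ c, IsPrimitive c (x + y) ∧ IsSmall c) :
    smallPrimitive (x + y) = smallPrimitive x + smallPrimitive y :=
  isPrimitive_eq_add hD (smallPrimitive_spec hx).1 (smallPrimitive_spec hy).1
    (smallPrimitive_spec hxy).1 (smallPrimitive_spec hx).2 (smallPrimitive_spec hy).2
    (smallPrimitive_spec hxy).2

/-- If no cut by a short relative cycle is balanced, short relative cycles have small primitives. -/
theorem exists_small_of_isRelCycle {m : ℕ}
    (hS : ∀ S : Set D.Face, (innerCutSet S).ncard ≤ m → D.numFaces ≤ 3 * S.ncard →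
      3 * Sᶜ.ncard < D.numFaces) {x : D.Dart → ZMod 2} (hx : IsRelCycle x)
    (hm : chainSize x ≤ 2 * m) : ∃ c, IsPrimitive c x ∧ IsSmall c := by
  obtain ⟨c, hc⟩ := hx.exists_isPrimitive
  by_cases hs : IsSmall c
  · exact ⟨c, hc, hs⟩
  -- When the support of `c` is not small, its complement is, and `c + 1` is also a primitive.
  · have h1 := hc.two_mul_ncard_le
    have h2 := hS (Function.support c) (by omega) (not_lt.1 hs)
    refine ⟨c + fun _ => 1, ?_, ?_⟩
    · have := hc.add (c' := fun _ => 1) (x' := 0) fun _ _ _ _ _ => (ZMod2.add_self 1).symm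
      rwa [add_zero] at this
    · have h3 : Function.support (c + fun _ => 1) = (Function.support c)ᶜ := by
        ext f
        simp only [Function.mem_support, Pi.add_apply, Set.mem_compl_iff, not_not]
        generalize c f = a
        revert a
        decide
      rw [IsSmall, h3]
      exact h2

/-- The path depends on the vertex only, so that the paths of adjacent edges cancel. It is empty at
boundary vertices, so that outer edges contribute nothing. -/
theorem exists_boundary_paths [DecidableEq D.Vertex] {ℓ h : ℕ}
    (hℓ : ∀ f : D.Face, D.regionLength (some f) = ℓ) (hh : D.nearBoundary h = Set.univ) :
    ∃ p : D.Vertex → D.Dart → ZMod 2, (∀ v, IsBoundary v → p v = 0) ∧ ∀ d,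
      p (D.src d) ∈ symChains D.rev ∧ chainSize (p (D.src d)) ≤ 2 * (ℓ * h) ∧
      ∃ w, IsBoundary w ∧ bdry D.src (p (D.src d)) = Pi.single (D.src d) 1 + Pi.single w 1 := by
  have : ∀ v : D.Vertex, ∃ x : D.Dart → ZMod 2, (IsBoundary v → x = 0) ∧ ∀ d, D.src d = v →
      x ∈ symChains D.rev ∧ chainSize x ≤ 2 * (ℓ * h) ∧
      ∃ w, IsBoundary w ∧ bdry D.src x = Pi.single v 1 + Pi.single w 1 := fun v => by
    by_cases hv : IsBoundary v
    · exact ⟨0, fun _ => rfl, fun _ _ => ⟨Submodule.zero_mem _, by rw [chainSize_zero]; omega, v,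
        hv, by rw [map_zero, ZMod2.fun_add_self]⟩⟩
    · by_cases hd : ∃ d, D.src d = v
      · obtain ⟨d, rfl⟩ := hd
        cases hl : D.left d with
        | none => exact (hv ⟨d, hl, rfl⟩).elim
        | some f =>
          obtain ⟨x, hx, w, hw, hb, hs⟩ := exists_chain_to_boundary hℓ h f (hh ▸ trivial) d hl
          exact ⟨x, fun h => (hv h).elim, fun _ _ => ⟨hx, hs, w, hw, hb⟩⟩
      · exact ⟨0, fun _ => rfl, fun d hdv => (hd ⟨d, hdv⟩).elim⟩
  choose p hp using this
  exact ⟨p, fun v => (hp v).1, fun d => (hp _).2 d rfl⟩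

/-- A disc of small depth has a short balanced cut. -/
theorem exists_balanced_cut {ℓ h : ℕ} (hℓ : ∀ f : D.Face, D.regionLength (some f) = ℓ)
    (hD : D.InnerConnected) (hN : 3 < D.numFaces) (hh : D.nearBoundary h = Set.univ) :
    ∃ S : Set D.Face, (innerCutSet S).ncard ≤ ℓ * (2 * h + 1) ∧ D.numFaces ≤ 3 * S.ncard ∧
      D.numFaces ≤ 3 * Sᶜ.ncard := by
  classical
  by_contra! hS
  obtain ⟨p, hp0, hp⟩ := exists_boundary_paths hℓ hh
  -- An arc of `i` edges with both ends joined to the boundary. For `i ≤ ℓ` it has at most ℓh + ℓ +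
  -- ℓh edges.
  let z : D.Dart → ℕ → D.Dart → ZMod 2 := fun d i =>
    p (D.src d) + arcChain d i + p (D.src (D.next^[i] d))
  have hz : ∀ d i, i ≤ ℓ → ∃ c, IsPrimitive c (z d i) ∧ IsSmall c := fun d i hi => by
    obtain ⟨h1, h2, w, hw, hb⟩ := hp d
    obtain ⟨h1', h2', w', hw', hb'⟩ := hp (D.next^[i] d)
    refine exists_small_of_isRelCycle hS ⟨Submodule.add_mem _ (Submodule.add_mem _ h1
      (arcChain_mem d i)) h1', w, w', hw, hw', ?_⟩ ?_
    · rw [map_add, map_add, hb, hb', bdry_arcChain, add_comm (Pi.single (D.src d) 1),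
        add_add_add_cancel_mid, add_add_add_cancel_mid]
    · have h3 := chainSize_add_le (p (D.src d) + arcChain d i) (p (D.src (D.next^[i] d)))
      have h4 := chainSize_add_le (p (D.src d)) (arcChain d i)
      have h5 := chainSize_arcChain_le d i
      change chainSize (p (D.src d) + arcChain d i + p (D.src (D.next^[i] d))) ≤ _
      nlinarith
  have hz0 : ∀ d, z d 0 = 0 := fun d => by
    simp only [z, arcChain_zero, add_zero, Function.iterate_zero, id]
    exact ZMod2.fun_add_self _
  have hzs : ∀ d i, z d (i + 1) = z d i + z (D.next^[i] d) 1 := fun d i => by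
    simp only [z, arcChain_succ, arcChain_zero, zero_add, Function.iterate_zero, id,
      Function.iterate_succ_apply', add_assoc]
    rw [← add_assoc (p (D.src (D.next^[i] d))), ZMod2.fun_add_self, zero_add]
  -- All partial arcs remain short, so additivity of small primitives applies at each step.
  have hsum : ∀ d i, i ≤ ℓ → smallPrimitive (z d i) =
      ∑ j ∈ Finset.range i, smallPrimitive (z (D.next^[j] d) 1) := fun d i => by
    induction i with
    | zero =>
      intro _
      rw [hz0, smallPrimitive_eq hD (by omega) isPrimitive_zero_zero (isSmall_zero (by omega)),
        Finset.sum_range_zero]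
    | succ i ih =>
      intro hi
      have h1 := hz d (i + 1) hi
      rw [hzs] at h1
      rw [hzs, smallPrimitive_add hD (hz d i (by omega)) (hz _ 1 (by omega)) h1, ih (by omega),
        Finset.sum_range_succ]
  have hface : ∀ f : D.Face, (Pi.single f 1 : D.Face → ZMod 2) =
      ∑ e ∈ Finset.univ.filter (fun e => D.left e = some f), smallPrimitive (z e 1) := fun f => by
    obtain ⟨d, hd⟩ := D.exists_left_eq_some f
    rw [← sum_next_iterate hℓ hd fun e => smallPrimitive (z e 1), ← hsum d ℓ le_rfl]
    -- After a full turn the two paths coincide and cancel, leaving the boundary of the face; its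
    -- small primitive is the face itself, as there are more than 3 faces.
    have h1 : z d ℓ = arcChain d ℓ := by
      simp only [z, next_iterate_regionLength hℓ hd]
      rw [add_comm (p (D.src d)), add_assoc, ZMod2.fun_add_self, add_zero]
    rw [h1]
    refine (smallPrimitive_eq hD (by omega) (isPrimitive_face hℓ hd) ?_).symm
    have h2 : Function.support (Pi.single f 1 : D.Face → ZMod 2) ⊆ {f} :=
      Pi.support_single_subset
    have h3 := Set.ncard_le_ncard h2 (Set.toFinite _)
    rw [Set.ncard_singleton] at h3
    unfold IsSmall
    omega
  have hrev : ∀ d, z (D.rev d) 1 = z d 1 := fun d => by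
    simp only [z, arcChain_one, edgeChain_rev _ D.rev_rev, Function.iterate_one, src_next,
      D.rev_rev]
    rw [add_assoc, add_assoc, add_left_comm, add_comm (p (D.src (D.rev d))), add_left_comm]
  have hout : ∀ d, D.left (D.rev d) = none → smallPrimitive (z d 1) = 0 := fun d hd => by
    refine smallPrimitive_eq hD (by omega) (fun e f g h1 h2 => ?_) (isSmall_zero (by omega))
    have hb : p (D.src d) = 0 := hp0 _ ⟨D.next (D.rev d), by rw [left_next, hd], D.src_next_rev d⟩
    have hb' : p (D.src (D.next d)) = 0 := hp0 _ ⟨D.rev d, hd, (D.src_next d).symm⟩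
    simp only [z, arcChain_one, Function.iterate_one, hb, hb', zero_add, add_zero, Pi.zero_apply]
    refine edgeChain_eq_zero (fun h => ?_) fun h => ?_
    · rw [h, hd] at h2
      exact Option.some_ne_none _ h2.symm
    · rw [h, hd] at h1
      exact Option.some_ne_none _ h1.symm
  -- In the sum over all faces each interior edge occurs once per dart with equal values, and outer
  -- edges give 0. But the sum is the constant 1.
  have htotal : ∑ f : D.Face, (Pi.single f 1 : D.Face → ZMod 2) = 0 := by
    calc ∑ f : D.Face, (Pi.single f 1 : D.Face → ZMod 2)
        = ∑ d ∈ Finset.univ.filter (fun d => D.left d ≠ none ∧ D.left (D.rev d) ≠ none),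
            smallPrimitive (z d 1) := by
          simp only [hface, Finset.sum_filter]
          rw [Finset.sum_comm]
          refine Finset.sum_congr rfl fun d _ => ?_
          cases hl : D.left d with
          | none => simp
          | some f =>
            by_cases hr : D.left (D.rev d) = none
            · simp [hr, hout d hr]
            · simp [hr]
      _ = 0 := by
          refine Finset.sum_involution (fun d _ => D.rev d) (fun d _ => ?_)
            (fun d _ _ => D.rev_ne d) (fun d hd => ?_) fun d _ => D.rev_rev d
          · rw [hrev, ZMod2.fun_add_self]
          · simpa [D.rev_rev, and_comm] using hd
  have hpos : 0 < Fintype.card D.Face := by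
    have : 3 < Nat.card D.Face := hN
    rw [Nat.card_eq_fintype_card] at this
    omega
  obtain ⟨f⟩ := Fintype.card_pos_iff.1 hpos
  have := congrFun htotal f
  simp [Finset.sum_apply, Pi.single_apply] at this

end DiscMap

/-! ### Numerical estimates. -/

/-- A diagram of `N` faces has depth less than `0.6 * √(N / C)`. -/
theorem exists_depth_bound {C t : ℝ} (hC : 0 < C) (hC1 : C ≤ 1) (ht : 54 ≤ t * C ^ 3) :
    ∃ h : ℕ, C * t ^ 2 < (1 + C) ^ h ∧ 2 * (h : ℝ) + 1 ≤ 1.22 * t := by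
  have ht54 : 54 ≤ t := by
    have hC3 : C ^ 3 ≤ 1 := pow_le_one₀ hC.le hC1
    by_contra! hlt
    rcases le_or_gt t 0 with h0 | h0
    · have := mul_nonpos_of_nonpos_of_nonneg h0 (pow_pos hC 3).le
      linarith
    · have := mul_le_mul_of_nonneg_left hC3 h0.le
      linarith
  -- Bernoulli's inequality to the fifth power, with h = 5m, gives (1 + C)^h ≥ (0.1tC)^5. This
  -- exceeds Ct² because t³C⁴ ≥ 54³ > 10⁵. Since t ≥ 54, also m ≥ 0.1t and 10m + 1 ≤ 1.22t.
  let m := ⌊0.12 * t⌋₊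
  have hm1 : (m : ℝ) ≤ 0.12 * t := Nat.floor_le (by positivity)
  have hm2 : 0.12 * t < m + 1 := Nat.lt_floor_add_one _
  refine ⟨m * 5, ?_, ?_⟩
  · have h1 : 1 + (m : ℝ) * C ≤ (1 + C) ^ m := one_add_mul_le_pow (by linarith) m
    have h2 : 0.1 * t * C ≤ m * C := mul_le_mul_of_nonneg_right (by linarith) hC.le
    have h3 : (0.1 * t * C) ^ 5 ≤ ((1 + C) ^ m) ^ 5 :=
      pow_le_pow_left₀ (by positivity) (by linarith) 5
    rw [pow_mul]
    refine lt_of_lt_of_le ?_ h3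
    have h4 : (54 : ℝ) ^ 3 ≤ (t * C ^ 3) ^ 3 := pow_le_pow_left₀ (by norm_num) ht 3
    have h5 : (t * C ^ 3) ^ 3 ≤ t ^ 3 * C ^ 4 := by
      have : C ^ 9 ≤ C ^ 4 := pow_le_pow_of_le_one hC.le hC1 (by norm_num)
      have h6 := mul_le_mul_of_nonneg_left this (show 0 ≤ t ^ 3 by positivity)
      calc (t * C ^ 3) ^ 3 = t ^ 3 * C ^ 9 := by ring
        _ ≤ _ := h6
    have h7 : (100000 : ℝ) < t ^ 3 * C ^ 4 := by
      linarith [show (100000 : ℝ) < 54 ^ 3 by norm_num]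
    have h8 : C * t ^ 2 * 100000 < C * t ^ 2 * (t ^ 3 * C ^ 4) :=
      mul_lt_mul_of_pos_left h7 (by positivity)
    have h9 : (0.1 * t * C) ^ 5 = C * t ^ 2 * (t ^ 3 * C ^ 4) / 100000 := by ring
    rw [h9]
    linarith
  · push_cast
    linarith

/-- Quantitative strict concavity of the square root. -/
theorem sqrt_add_sqrt_ge {x y : ℝ} (hx : (x + y) / 4 ≤ x) (hy : (x + y) / 4 ≤ y) :
    1.36 * √(x + y) ≤ √x + √y := by
  have hx0 : 0 ≤ x := by linarith
  have hy0 : 0 ≤ y := by linarith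
  -- Here xy ≥ (3/16)(x + y)², and √3/4 > 0.4325; then 1 + 2 · 0.4325 > 1.36².
  have h1 : 0.4325 * (x + y) ≤ √x * √y := by
    rw [← Real.sqrt_mul hx0]
    refine Real.le_sqrt_of_sq_le ?_
    nlinarith
  refine le_of_sq_le_sq ?_ (by positivity)
  nlinarith [Real.sq_sqrt hx0, Real.sq_sqrt hy0, Real.sq_sqrt (add_nonneg hx0 hy0)]

/-! ### Balanced cuts of diagrams and the induction on the number of faces. -/

namespace VanKampenDiagram

variable {α : Type*} {R : Set (List (α × Bool))}

theorem regionLength_eq {ℓ : ℕ} (hR : ∀ r ∈ R, r.length = ℓ) (D : VanKampenDiagram R)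
    (f : D.Face) : D.regionLength (some f) = ℓ := by
  obtain ⟨d, hd⟩ := D.exists_left_eq_some f
  have hlen : ((D.boundaryCycle d).map D.label).length = D.regionLength (some f) := by
    rw [List.length_map, DiscMap.boundaryCycle, List.length_iterate, hd]
  obtain ⟨r, hr, h⟩ := D.face_relator d f hd
  rw [← hlen, ← hR r hr]
  rcases h with h | h
  · exact h.perm.length_eq
  · rw [h.perm.length_eq, FreeGroup.invRev_length]

/-- A linear isoperimetric inequality for diagrams with at most `S.ncard` faces applies to `S`. -/
theorem mul_ncard_le_cutLength (κ : ℝ) (D : VanKampenDiagram R) (hD : D.IsReduced)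
    (S : Set D.Face) (hS : D.Cosimple S)
    (h : ∀ D' : VanKampenDiagram R, D'.IsReduced → D'.InnerConnected →
      D'.numFaces ≤ S.ncard → κ * D'.numFaces ≤ D'.boundaryLength) :
    κ * S.ncard ≤ D.cutLength S := by
  refine DiscMap.mul_ncard_le_cutLength κ S hS fun A hAS hA hconn hout => ?_
  obtain ⟨D', hD', hinner, hnum, hlen⟩ := D.exists_subdiagram hD hA hconn hout
  rw [← hnum, ← hlen]
  exact h D' hD' hinner (by rw [hnum]; exact Set.ncard_le_ncard hAS (Set.toFinite _))

theorem mul_ncard_le_cutLength_of_forall {κ : ℝ} (hκ : 0 ≤ κ)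
    (h : ∀ D : VanKampenDiagram R, D.IsReduced → κ * D.numFaces ≤ D.boundaryLength)
    (D : VanKampenDiagram R) (hD : D.IsReduced) (S : Set D.Face) :
    κ * S.ncard ≤ D.cutLength S := by
  refine DiscMap.mul_ncard_le_cutLength_of_discs hκ (fun A hA hconn hout => ?_) S
  obtain ⟨D', hD', _, hnum, hlen⟩ := D.exists_subdiagram hD hA hconn hout
  rw [← hnum, ← hlen]
  exact h D' hD'

/-- A large diagram has a short cut into two parts, each containing a quarter of the faces, which
are disjoint unions of discs. -/
theorem exists_cosimple_balanced_cut {ℓ : ℕ} {C : ℝ} (hℓ : 0 < ℓ) (hC : 0 < C)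
    (hR : ∀ r ∈ R, r.length = ℓ)
    (hglobal : ∀ D : VanKampenDiagram R, D.IsReduced →
      C * ℓ * D.numFaces ≤ D.boundaryLength)
    (D : VanKampenDiagram R) (hD : D.IsReduced) (hinner : D.InnerConnected)
    (hN : 3000 / C ^ 5 ≤ D.numFaces) :
    ∃ A : Set D.Face, D.Cosimple A ∧ D.Cosimple Aᶜ ∧
      ((DiscMap.innerCutSet A).ncard : ℝ) ≤ ℓ * (1.22 * √(D.numFaces / C)) ∧
      (D.numFaces : ℝ) / 4 ≤ A.ncard ∧ (D.numFaces : ℝ) / 4 ≤ Aᶜ.ncard := by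
  have hℓ' : (0 : ℝ) < ℓ := by exact_mod_cast hℓ
  have hlen := D.regionLength_eq hR
  have hκ : 0 < C * ℓ := by positivity
  have hiso := mul_ncard_le_cutLength_of_forall hκ.le hglobal D hD
  have hNpos : (0 : ℝ) < D.numFaces := lt_of_lt_of_le (by positivity) hN
  -- A single face has at most ℓ boundary edges.
  have hC1 : C ≤ 1 := by
    have : 0 < Nat.card D.Face := by exact_mod_cast hNpos
    obtain ⟨f⟩ := (Nat.card_pos_iff.1 this).1
    have h1 := hiso {f}
    have h2 : D.cutLength {f} ≤ ℓ * ({f} : Set D.Face).ncard :=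
      (Set.ncard_le_ncard (fun d hd => hd.1) (Set.toFinite _)).trans
        (DiscMap.ncard_inSet_le hlen {f})
    have h3 : (D.cutLength {f} : ℝ) ≤ ℓ * ({f} : Set D.Face).ncard := by exact_mod_cast h2
    rw [Set.ncard_singleton] at h1 h3
    push_cast at h1 h3
    refine le_of_mul_le_mul_right ?_ hℓ'
    linarith
  let t := √(D.numFaces / C)
  have ht0 : 0 ≤ t := Real.sqrt_nonneg _
  have ht2 : C * t ^ 2 = D.numFaces := by
    rw [Real.sq_sqrt (by positivity)]
    field_simp
  -- The origin of the constant 3000: (tC³)² = NC⁵ ≥ 3000 > 54².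
  have ht : 54 ≤ t * C ^ 3 := by
    refine le_of_sq_le_sq ?_ (by positivity)
    have h1 : 3000 ≤ (D.numFaces : ℝ) * C ^ 5 := (div_le_iff₀ (by positivity)).1 hN
    calc (54 : ℝ) ^ 2 ≤ 3000 := by norm_num
      _ ≤ D.numFaces * C ^ 5 := h1
      _ = (t * C ^ 3) ^ 2 := by rw [← ht2]; ring
  obtain ⟨h, hh, hht⟩ := exists_depth_bound hC hC1 ht
  rw [ht2] at hh
  have hnear := DiscMap.nearBoundary_eq_univ hC hℓ hlen hiso h hh
  have hN3 : 3 < D.numFaces := by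
    have h1 : (3000 : ℝ) ≤ 3000 / C ^ 5 :=
      (le_div_iff₀ (by positivity)).2 (by nlinarith [pow_le_one₀ (n := 5) hC.le hC1])
    have h2 : (3 : ℝ) < D.numFaces := by linarith
    exact_mod_cast h2
  obtain ⟨S, hS, hS1, hS2⟩ := DiscMap.exists_balanced_cut hlen hinner hN3 hnear
  have hm : ((DiscMap.innerCutSet S).ncard : ℝ) ≤ ℓ * (1.22 * t) := by
    have : ((DiscMap.innerCutSet S).ncard : ℝ) ≤ ℓ * (2 * h + 1) := by exact_mod_cast hS
    exact this.trans (mul_le_mul_of_nonneg_left hht hℓ'.le)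
  obtain ⟨A, hA, hA', hAm, h1, h2⟩ := DiscMap.exists_cosimple_cut hiso hκ.le S hm
  have hS1' : (D.numFaces : ℝ) ≤ 3 * S.ncard := by exact_mod_cast hS1
  have hS2' : (D.numFaces : ℝ) ≤ 3 * Sᶜ.ncard := by exact_mod_cast hS2
  -- Filling holes moves at most N/12 faces, so a third of the faces remains at least a quarter.
  have hsmall : 1.22 * t ≤ C * (D.numFaces / 12) := by
    have h3 : t * C ^ 3 ≤ t * C ^ 2 :=
      mul_le_mul_of_nonneg_left (pow_le_pow_of_le_one hC.le hC1 (by norm_num)) ht0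
    have h4 : t * 54 ≤ t * (t * C ^ 2) := mul_le_mul_of_nonneg_left (ht.trans h3) ht0
    rw [← ht2]
    linarith
  have hquarter : ∀ x y : ℝ, (D.numFaces : ℝ) ≤ 3 * x → C * ℓ * x ≤ C * ℓ * y + ℓ * (1.22 * t) →
      (D.numFaces : ℝ) / 4 ≤ y := fun x y hx hxy => by
    have h3 : C * x ≤ C * y + 1.22 * t := by
      refine le_of_mul_le_mul_left ?_ hℓ'
      linarith
    have h4 : C * x ≤ C * (y + D.numFaces / 12) := by linarith
    have := le_of_mul_le_mul_left h4 hC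
    linarith
  exact ⟨A, hA, hA', hAm, hquarter _ _ hS1' h1, hquarter _ _ hS2' h2⟩

/-- The isoperimetric inequality for large diagrams, with the correction term that makes the
induction on the number of faces work. -/
theorem le_boundaryLength_of_large {ℓ : ℕ} {C β K : ℝ} (hℓ : 0 < ℓ) (hC : 0 < C)
    (hR : ∀ r ∈ R, r.length = ℓ)
    (hglobal : ∀ D : VanKampenDiagram R, D.IsReduced →
      C * ℓ * D.numFaces ≤ D.boundaryLength)
    (hK : 3000 / C ^ 5 ≤ K)
    (hlocal : ∀ D : VanKampenDiagram R, D.IsReduced → (D.numFaces : ℝ) ≤ K →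
      β * ℓ * D.numFaces ≤ D.boundaryLength)
    (D : VanKampenDiagram R) (hD : D.IsReduced) (hinner : D.InnerConnected)
    (hN : K < D.numFaces) :
    (β - 14 / √(K * C) + 7 / √(D.numFaces * C)) * ℓ * D.numFaces ≤ D.boundaryLength := by
  induction hn : D.numFaces using Nat.strong_induction_on generalizing D with
  | _ n ih =>
    subst hn
    have hℓ' : (0 : ℝ) < ℓ := by exact_mod_cast hℓ
    have hK0 : 0 < K := lt_of_lt_of_le (by positivity) hK
    have hN0 : (0 : ℝ) < D.numFaces := hK0.trans hN
    obtain ⟨A, hA, hA', hcut, hx, hy⟩ :=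
      D.exists_cosimple_balanced_cut hℓ hC hR hglobal hD hinner (hK.trans hN.le)
    have hadd : (A.ncard : ℝ) + Aᶜ.ncard = D.numFaces := by
      exact_mod_cast Set.ncard_add_ncard_compl A (Set.toFinite _) (Set.toFinite _)
    have hpart : ∀ T : Set D.Face, D.Cosimple T → (D.numFaces : ℝ) / 4 ≤ T.ncard →
        (T.ncard : ℝ) < D.numFaces →
        ((β - 14 / √(K * C)) * T.ncard + 7 / √C * √T.ncard) * ℓ ≤ D.cutLength T :=
      fun T hT hT1 hT2 => by
        have hT0 : (0 : ℝ) < T.ncard := by linarith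
        have h1 := mul_ncard_le_cutLength ((β - 14 / √(K * C) + 7 / √(T.ncard * C)) * ℓ) D hD T hT
          fun D' hD' hinner' hle => by
            have hle' : (D'.numFaces : ℝ) ≤ T.ncard := by exact_mod_cast hle
            rcases le_or_gt (D'.numFaces : ℝ) K with hsmall | hlarge
            · refine le_trans ?_ (hlocal D' hD' hsmall)
              refine mul_le_mul_of_nonneg_right (mul_le_mul_of_nonneg_right ?_ hℓ'.le)
                (Nat.cast_nonneg _)
              -- The part has more than K/4 faces, so its correction 7/√(|T|C) is absorbed by
              -- 14/√(KC) and the local density β suffices.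
              have h2 : √(K * C) / 2 ≤ √(T.ncard * C) := by
                refine Real.le_sqrt_of_sq_le ?_
                rw [div_pow, Real.sq_sqrt (by positivity)]
                nlinarith
              have h3 : 7 / √(T.ncard * C) ≤ 7 / (√(K * C) / 2) :=
                div_le_div_of_nonneg_left (by norm_num) (by positivity) h2
              have h4 : 7 / (√(K * C) / 2) = 14 / √(K * C) := by
                rw [div_div_eq_mul_div]
                norm_num
              linarith
            · refine le_trans ?_ (ih D'.numFaces (by exact_mod_cast hle'.trans_lt hT2) D' hD'
                hinner' hlarge rfl)
              refine mul_le_mul_of_nonneg_right (mul_le_mul_of_nonneg_right ?_ hℓ'.le)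
                (Nat.cast_nonneg _)
              have hD0 : (0 : ℝ) < D'.numFaces := hK0.trans hlarge
              -- The correction decreases with the size, so a disc inside the part satisfies a bound
              -- at least as strong as that for the whole part.
              have h2 : 7 / √(T.ncard * C) ≤ 7 / √(D'.numFaces * C) :=
                div_le_div_of_nonneg_left (by norm_num) (by positivity)
                  (Real.sqrt_le_sqrt (mul_le_mul_of_nonneg_right hle' hC.le))
              linarith
        refine le_trans (le_of_eq ?_) h1
        have h2 : 7 / √(T.ncard * C) * T.ncard = 7 / √C * √T.ncard := by
          rw [Real.sqrt_mul hT0.le]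
          have hs : 0 < √(T.ncard : ℝ) := Real.sqrt_pos.2 hT0
          have hc : 0 < √C := Real.sqrt_pos.2 hC
          field_simp
          exact (Real.sq_sqrt hT0.le).symm
        rw [← h2]
        ring
    have h1 := hpart A hA hx (by linarith)
    have h2 := hpart Aᶜ hA' hy (by linarith)
    have h3 : (D.cutLength A : ℝ) + D.cutLength Aᶜ ≤
        D.boundaryLength + 2 * (DiscMap.innerCutSet A).ncard := by
      exact_mod_cast DiscMap.cutLength_add_cutLength_compl_le A
    have h4 : 1.36 * √(D.numFaces : ℝ) ≤ √(A.ncard : ℝ) + √(Aᶜ.ncard : ℝ) := by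
      rw [← hadd]
      exact sqrt_add_sqrt_ge (by rw [hadd]; exact hx) (by rw [hadd]; exact hy)
    have hc : 0 < √C := Real.sqrt_pos.2 hC
    have h5 : √(D.numFaces / C) = √D.numFaces / √C := Real.sqrt_div hN0.le C
    have h6 : 7 / √(D.numFaces * C) * D.numFaces = 7 * √(D.numFaces / C) := by
      rw [h5, Real.sqrt_mul hN0.le]
      have hs : 0 < √(D.numFaces : ℝ) := Real.sqrt_pos.2 hN0
      field_simp
      exact (Real.sq_sqrt hN0.le).symm
    have h7 : 9.52 * √(D.numFaces / C) ≤
        7 / √C * √(A.ncard : ℝ) + 7 / √C * √(Aᶜ.ncard : ℝ) := by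
      have := mul_le_mul_of_nonneg_left h4 (show 0 ≤ 7 / √C by positivity)
      have e : 7 / √C * (1.36 * √(D.numFaces : ℝ)) = 9.52 * √(D.numFaces / C) := by
        rw [h5]
        ring
      linarith
    -- The constants close up: 7 · 1.36 = 9.52 and 9.52 - 2 · 1.22 = 7.08 ≥ 7.
    have h8 : 7 * √(D.numFaces / C) ≤ 7 / √C * √(A.ncard : ℝ) + 7 / √C * √(Aᶜ.ncard : ℝ) -
        2.44 * √(D.numFaces / C) := by
      linarith [Real.sqrt_nonneg (D.numFaces / C)]
    have h9 := mul_le_mul_of_nonneg_right h8 hℓ'.le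
    calc (β - 14 / √(K * C) + 7 / √(D.numFaces * C)) * ℓ * D.numFaces
        = (β - 14 / √(K * C)) * (A.ncard + Aᶜ.ncard) * ℓ + 7 * √(D.numFaces / C) * ℓ := by
          rw [← h6, hadd]
          ring
      _ ≤ D.boundaryLength := by linarith

end VanKampenDiagram

theorem mainTheorem2 {α : Type*} (ℓ : ℕ) (R : Set (List (α × Bool)))
    (hR : ∀ r ∈ R, FreeGroup.IsReduced r ∧ r.length = ℓ)
    (C β K : ℝ) (hC : 0 < C)
    (hglobal : ∀ D : VanKampenDiagram R, D.IsReduced →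
      C * ℓ * D.numFaces ≤ D.boundaryLength)
    (hK : 3000 / C ^ 5 ≤ K)
    (hlocal : ∀ D : VanKampenDiagram R, D.IsReduced → (D.numFaces : ℝ) ≤ K →
      β * ℓ * D.numFaces ≤ D.boundaryLength) :
    ∀ D : VanKampenDiagram R, D.IsReduced →
      (β - 14 / Real.sqrt (K * C)) * ℓ * D.numFaces ≤ D.boundaryLength := by
  intro D hD
  rcases Nat.eq_zero_or_pos ℓ with rfl | hℓ
  · rw [Nat.cast_zero, mul_zero, zero_mul]
    exact Nat.cast_nonneg _
  -- The set of all faces is trivially cosimple; passing to its components drops filaments and cut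
  -- vertices and leaves inner connected discs.
  have h1 := D.mul_ncard_le_cutLength ((β - 14 / √(K * C)) * ℓ) hD Set.univ
    (fun f hf => (hf trivial).elim) fun D' hD' hinner _ => by
      rcases le_or_gt (D'.numFaces : ℝ) K with hsmall | hlarge
      · refine le_trans ?_ (hlocal D' hD' hsmall)
        refine mul_le_mul_of_nonneg_right (mul_le_mul_of_nonneg_right ?_ (Nat.cast_nonneg _))
          (Nat.cast_nonneg _)
        linarith [show 0 ≤ 14 / √(K * C) by positivity]
      · refine le_trans ?_ (D'.le_boundaryLength_of_large hℓ hC (fun r hr => (hR r hr).2) hglobal hK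
          hlocal hD' hinner hlarge)
        refine mul_le_mul_of_nonneg_right (mul_le_mul_of_nonneg_right ?_ (Nat.cast_nonneg _))
          (Nat.cast_nonneg _)
        linarith [show 0 ≤ 7 / √(D'.numFaces * C) by positivity]
  rw [Set.ncard_univ] at h1
  refine h1.trans ?_
  exact_mod_cast DiscMap.cutLength_univ_le
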